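/- **Setting.** For $\ell\ge 1$, $\lambda>0$ and $\underline h=(h_1,\dots,h_\ell)\in\mathbb R^\ell$ let $$Z_{\ell,\underline h}=\sum_{\sigma\in\{-1,1\}^{\ell}}\exp\Big(\sum_{i=1}^{\ell}\{\lambda\sigma(i)\sigma(i+1)+h_i\sigma(i)\}\Big),\qquad Z^*_{\ell,\underline h}=Z_{\ell,\underline h}\prod_{i=1}^\ell(e^{h_i}+e^{-h_i})^{-1},$$ where all site indices are taken modulo $\ell$. Put $u_i=\tanh h_i$ and $m_i=\partial_{h_i}\log Z_{\ell,\underline h}$, let $A_0$ be the constant term of $\log Z^*_{\ell,\underline h}$ as a power series in $\underline u=(u_1,\dots,u_\ell)$ (that is, its value at $\underline u=0$), and define $\Psi_i$, $\Phi_i$, $\Theta$ by $$m_i=u_i+\Psi_i,\qquad \Psi_i=\lambda(1-u_i^2)(u_{i+1}+u_{i-1})+\Phi_i,\qquad \log Z^*_{\ell,\underline h}-A_0=-\frac\lambda2\sum_{i=1}^\ell(u_{i+1}-u_i)^2+\Theta .$$ Let $h^*>3$ be the solution of $3/\cosh^2(h^*-3)=1/4$, and for $h_{\rm ext}\in\mathbb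 R$ let $$H^{(1)}_{\ell,\underline h}=\sum_{i=1}^\ell\Big\{(h_i-u_i)\Phi_i-h_{\rm ext}\Phi_i-\frac{\Psi_i^2}2\Big\}-\Theta .$$ **Theorem.** There is $\lambda_0>0$ such that for every $h_+>0$ there is a constant $c>0$ with the following property. For all $\lambda\in(0,\lambda_0)$, all $\ell\ge1$ and all $h_{\rm ext}\in[0,h^*]$ there are a continuous function $f^{(1)}$ on $[-1,1]$ and functions $b^{(1)}_{i,j}(\underline u)$, $1\le i<j\le\ell$, such that for every $\underline h$ with $|h_i|\le h_+$ for all $i$, $$H^{(1)}_{\ell,\underline h}=\sum_{i=1}^\ell f^{(1)}(u_i)+\sum_{1\le i<j\le\ell}b^{(1)}_{i,j}(\underline u)(u_i-u_j)^2$$ and $$\sum_{1\le i<j\le\ell}b^{(1)}_{i,j}(\underline u)(u_i-u_j)^2\ \ge\ -c\,\lambda^{1+\frac23}\sum_{i=1}^\ell(u_i-u_{i+1})^2 .$$ -/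

import Mathlib

namespace IsingLayers

open Finset

noncomputable section

/-- The upper end `h*` of the range of the external field: the root larger than `3` of
`3 / cosh² (h* - 3) = 1 / 4`. -/
def hStar : ℝ := 3 + Real.arcosh (Real.sqrt 12)

theorem hStar_spec : 3 < hStar ∧ 3 / Real.cosh (hStar - 3) ^ 2 = 1 / 4 := by
  have h1 : (1 : ℝ) < Real.sqrt 12 := by
    rw [Real.lt_sqrt] <;> norm_num
  constructor
  · have := Real.arcosh_pos h1
    unfold hStar
    linarith
  · have h2 : hStar - 3 = Real.arcosh (Real.sqrt 12) := by unfold hStar; ring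
    rw [h2, Real.cosh_arcosh h1.le, Real.sq_sqrt (by norm_num)]
    norm_num

variable {ℓ : ℕ} [NeZero ℓ]

/-- Partition function of the one-dimensional Ising ring with `ℓ` sites (addition in `Fin ℓ` is
cyclic), nearest neighbour coupling `lam` and magnetic fields `h i`. -/
def Z (lam : ℝ) (h : Fin ℓ → ℝ) : ℝ :=
  ∑ σ : Fin ℓ → ℤˣ,
    Real.exp (∑ i, (lam * ((σ i : ℤ) : ℝ) * ((σ (i + 1) : ℤ) : ℝ) + h i * ((σ i : ℤ) : ℝ)))

/-- `Z*`: the partition function divided by that of the free spins. -/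
def ZStar (lam : ℝ) (h : Fin ℓ → ℝ) : ℝ :=
  Z lam h * (∏ i, (Real.exp (h i) + Real.exp (-(h i))))⁻¹

/-- `u i = tanh (h i)`. -/
def u (h : Fin ℓ → ℝ) (i : Fin ℓ) : ℝ := Real.tanh (h i)

/-- The constant term `A₀` of the power series of `log Z*` in the variables `u`, that is, the value
of `log Z*` at `u = 0`, equivalently at `h = 0`. -/
def A0 (ℓ : ℕ) [NeZero ℓ] (lam : ℝ) : ℝ := Real.log (ZStar lam (0 : Fin ℓ → ℝ))

/-- The magnetization `m i = ∂ log Z / ∂ h i`. -/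
def m (lam : ℝ) (h : Fin ℓ → ℝ) (i : Fin ℓ) : ℝ :=
  deriv (fun t => Real.log (Z lam (Function.update h i t))) (h i)

/-- `Ψ i`, defined by `m i = u i + Ψ i`. -/
def Psi (lam : ℝ) (h : Fin ℓ → ℝ) (i : Fin ℓ) : ℝ := m lam h i - u h i

/-- `Φ i`, defined by `Ψ i = lam (1 - (u i)²) (u (i+1) + u (i-1)) + Φ i`. -/
def Phi (lam : ℝ) (h : Fin ℓ → ℝ) (i : Fin ℓ) : ℝ :=
  Psi lam h i - lam * (1 - u h i ^ 2) * (u h (i + 1) + u h (i - 1))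

/-- `Θ`, defined by `log Z* - A₀ = -(lam / 2) ∑ i, (u (i+1) - u i)² + Θ`. -/
def Theta (lam : ℝ) (h : Fin ℓ → ℝ) : ℝ :=
  Real.log (ZStar lam h) - A0 ℓ lam + lam / 2 * ∑ i, (u h (i + 1) - u h i) ^ 2

/-- The remainder `H⁽¹⁾` of the effective Hamiltonian. -/
def H1 (lam hext : ℝ) (h : Fin ℓ → ℝ) : ℝ :=
  ∑ i, ((h i - u h i) * Phi lam h i - hext * Phi lam h i - Psi lam h i ^ 2 / 2) - Theta lam h

end

end IsingLayers

namespace IsingLayers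

open Finset

noncomputable section

/-- A bounded holomorphic function on the polydisc of radius `2` is Lipschitz on the unit
polydisc. -/
theorem norm_sub_le_of_bounded_polydisc {ι : Type*} [Fintype ι] {q : (ι → ℂ) → ℂ} {K : ℝ}
    (hd : DifferentiableOn ℂ q (Metric.ball 0 2)) (hK : ∀ x ∈ Metric.ball (0 : ι → ℂ) 2, ‖q x‖ ≤ K)
    {c y : ι → ℂ} (hc : ‖c‖ ≤ 1) (hy : ‖y‖ ≤ 1) : ‖q y - q c‖ ≤ 2 * K * ‖y - c‖ := by
  have hcm : c ∈ Metric.ball (0 : ι → ℂ) 2 := by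
    rw [mem_ball_zero_iff]; linarith
  have hym : y ∈ Metric.ball (0 : ι → ℂ) 2 := by
    rw [mem_ball_zero_iff]; linarith
  have hKc := hK c hcm
  have hKy := hK y hym
  have hK0 : 0 ≤ K := (norm_nonneg _).trans hKc
  rcases lt_or_ge ‖y - c‖ 1 with h | h
  · have hsub : Metric.ball c 1 ⊆ Metric.ball (0 : ι → ℂ) 2 := by
      refine Metric.ball_subset_ball' ?_
      rw [dist_zero_right]; linarith
    have := Complex.dist_le_div_mul_dist_of_mapsTo_ball (f := q) (c := c) (z := y) (R₁ := 1)
      (R₂ := 2 * K) (hd.mono hsub) ?_ ?_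
    · simpa [dist_eq_norm] using this
    · intro x hx
      rw [mem_closedBall_iff_norm]
      calc ‖q x - q c‖ ≤ ‖q x‖ + ‖q c‖ := norm_sub_le _ _
        _ ≤ 2 * K := by linarith [hK x (hsub hx)]
    · rwa [mem_ball_iff_norm]
  · calc ‖q y - q c‖ ≤ ‖q y‖ + ‖q c‖ := norm_sub_le _ _
      _ ≤ 2 * K := by linarith
      _ ≤ 2 * K * ‖y - c‖ := le_mul_of_one_le_right (by linarith) h

/-- First order expansion of a holomorphic function of many variables whose partial derivatives
are bounded individually: the coordinates are switched on in the order given by `d`. -/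
theorem norm_sub_sub_sum_le_of_shells {ι : Type*} [Fintype ι] [DecidableEq ι]
    {g : (ι → ℂ) → ℂ} {K : ι → ℝ} (d : ι → ℕ)
    (hg : DifferentiableOn ℂ g (Metric.ball 0 2)) {v c : ι → ℂ}
    (hq : ∀ j, v j ≠ 0 →
      DifferentiableOn ℂ (fun x => fderiv ℂ g x (Pi.single j 1)) (Metric.ball 0 2))
    (hK : ∀ j, v j ≠ 0 → ∀ x ∈ Metric.ball (0 : ι → ℂ) 2, ‖fderiv ℂ g x (Pi.single j 1)‖ ≤ K j)
    (hK0 : ∀ j, 0 ≤ K j) (hc : ‖c‖ ≤ 1) (hcv : ‖c + v‖ ≤ 1) :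
    ‖g (c + v) - g c - ∑ j, v j * fderiv ℂ g c (Pi.single j 1)‖
      ≤ ∑ j, 2 * K j * ∑ k with d k ≤ d j, ‖v k‖ ^ 2 := by
  have hconv : ∀ (θ : ι → ℝ), (∀ k, 0 ≤ θ k ∧ θ k ≤ 1) → ‖fun k => c k + (θ k : ℂ) * v k‖ ≤ 1 := by
    intro θ hθ
    rw [pi_norm_le_iff_of_nonneg zero_le_one]
    intro k
    have h1 : ‖c k‖ ≤ 1 := (norm_le_pi_norm c k).trans hc
    have h2 : ‖c k + v k‖ ≤ 1 := (norm_le_pi_norm (c + v) k).trans hcv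
    have h3 : c k + (θ k : ℂ) * v k = ((1 - θ k : ℝ) : ℂ) * c k + ((θ k : ℝ) : ℂ) * (c k + v k) := by
      push_cast; ring
    rw [h3]
    refine (norm_add_le _ _).trans ?_
    rw [norm_mul, norm_mul, Complex.norm_of_nonneg (hθ k).1,
      Complex.norm_of_nonneg (by linarith [(hθ k).2])]
    nlinarith [(hθ k).1, (hθ k).2, norm_nonneg (c k), norm_nonneg (c k + v k)]
  set y : ℕ → ι → ℂ := fun r k => c k + (if d k < r then v k else 0) with hy
  have hstep : ∀ r, ‖g (y (r + 1)) - g (y r)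
      - ∑ j with d j = r, v j * fderiv ℂ g c (Pi.single j 1)‖
      ≤ ∑ j with d j = r, 2 * K j * ∑ k with d k ≤ d j, ‖v k‖ ^ 2 := by
    intro r
    set V : ι → ℂ := fun k => if d k = r then v k else 0 with hV
    set S : ℂ := ∑ j with d j = r, v j * fderiv ℂ g c (Pi.single j 1)
    have hyr : ∀ t : ℝ, y r + (t : ℂ) • V
        = fun k => c k + ((if d k < r then 1 else if d k = r then t else 0 : ℝ) : ℂ) * v k := by
      intro t
      funext k
      simp only [hy, hV, Pi.add_apply, Pi.smul_apply, smul_eq_mul]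
      rcases lt_trichotomy (d k) r with h | h | h
      · simp [h, h.ne]
      · simp [h]
      · simp [h.ne', h.not_gt]
    have hin : ∀ t : ℝ, 0 ≤ t → t ≤ 1 → ‖y r + (t : ℂ) • V‖ ≤ 1 := by
      intro t h0 h1
      rw [hyr]
      refine hconv _ fun k => ?_
      split_ifs <;> constructor <;> linarith
    have hdist : ∀ t : ℝ, 0 ≤ t → t ≤ 1 → ‖y r + (t : ℂ) • V - c‖ ^ 2
        ≤ ∑ k with d k ≤ r, ‖v k‖ ^ 2 := by
      intro t h0 h1
      have hnn : 0 ≤ ∑ k with d k ≤ r, ‖v k‖ ^ 2 := sum_nonneg fun _ _ => by positivity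
      have : ‖y r + (t : ℂ) • V - c‖ ≤ Real.sqrt (∑ k with d k ≤ r, ‖v k‖ ^ 2) := by
        rw [pi_norm_le_iff_of_nonneg (Real.sqrt_nonneg _)]
        intro k
        apply Real.le_sqrt_of_sq_le
        rw [hyr, Pi.sub_apply, add_sub_cancel_left, norm_mul, mul_pow]
        by_cases hk : d k ≤ r
        · have h2 : ‖v k‖ ^ 2 ≤ ∑ k with d k ≤ r, ‖v k‖ ^ 2 :=
            single_le_sum (f := fun k => ‖v k‖ ^ 2) (fun _ _ => by positivity)
              (by simpa using hk)
          refine (mul_le_of_le_one_left (by positivity) ?_).trans h2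
          rw [Complex.norm_real, Real.norm_eq_abs, sq_abs]
          split_ifs <;> nlinarith
        · have h3 : ¬ d k < r := by omega
          have h4 : ¬ d k = r := by omega
          simpa [h3, h4] using hnn
      calc _ ≤ Real.sqrt (∑ k with d k ≤ r, ‖v k‖ ^ 2) ^ 2 := by gcongr
        _ = _ := Real.sq_sqrt hnn
    have hVsum : V = ∑ j with d j = r, v j • (Pi.single j 1 : ι → ℂ) := by
      funext k
      simp [hV, Finset.sum_apply, Pi.single_apply, Finset.sum_ite_eq]
    have hV2 : ∀ j, d j = r → ‖v j‖ ^ 2 ≤ ∑ k with d k ≤ r, ‖v k‖ ^ 2 := fun j hj =>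
      single_le_sum (f := fun k => ‖v k‖ ^ 2) (fun _ _ => by positivity)
              (by simpa using hj.le)
    have hder : ∀ t ∈ Set.Icc (0 : ℝ) 1, HasDerivWithinAt
        (fun t : ℝ => g (y r + (t : ℂ) • V) - (t : ℂ) * S)
        (∑ j with d j = r, v j * (fderiv ℂ g (y r + (t : ℂ) • V) (Pi.single j 1)
          - fderiv ℂ g c (Pi.single j 1))) (Set.Icc 0 1) t := by
      intro t ht
      have hmem : y r + (t : ℂ) • V ∈ Metric.ball (0 : ι → ℂ) 2 := by
        rw [mem_ball_zero_iff]; linarith [hin t ht.1 ht.2]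
      have h1 : HasFDerivAt g (fderiv ℂ g (y r + (t : ℂ) • V)) (y r + (t : ℂ) • V) :=
        ((hg _ hmem).differentiableAt (Metric.isOpen_ball.mem_nhds hmem)).hasFDerivAt
      have h2 : HasDerivAt (fun z : ℂ => y r + z • V) V (t : ℂ) := by
        simpa using ((hasDerivAt_id (t : ℂ)).smul_const V).const_add (y r)
      have h3 := (h1.comp_hasDerivAt (t : ℂ) h2).comp_ofReal
      have h4 : HasDerivAt (fun t : ℝ => (t : ℂ) * S) S t := by
        simpa using ((hasDerivAt_id (t : ℂ)).mul_const S).comp_ofReal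
      have h5 := h3.sub h4
      refine HasDerivAt.hasDerivWithinAt ?_
      have h6 : fderiv ℂ g (y r + (t : ℂ) • V) V
          = ∑ j with d j = r, v j * fderiv ℂ g (y r + (t : ℂ) • V) (Pi.single j 1) := by
        generalize fderiv ℂ g (y r + (t : ℂ) • V) = A
        rw [hVsum, map_sum]
        simp only [map_smul, smul_eq_mul]
      rw [h6] at h5
      have h7 := h5.congr_deriv (g' := ∑ j with d j = r, v j * (fderiv ℂ g (y r + (t : ℂ) • V)
        (Pi.single j 1) - fderiv ℂ g c (Pi.single j 1))) ?_
      · exact h7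
      simp only [mul_sub, sum_sub_distrib, S]
    have hbd := norm_image_sub_le_of_norm_deriv_le_segment_01' hder
      (C := ∑ j with d j = r, 2 * K j * ∑ k with d k ≤ d j, ‖v k‖ ^ 2) ?_
    · have e1 : y r + ((1 : ℝ) : ℂ) • V = y (r + 1) := by
        funext k
        simp only [hy, hV, Pi.add_apply, Pi.smul_apply, smul_eq_mul]
        rcases lt_trichotomy (d k) r with h | h | h
        · simp [h, h.ne, Nat.lt_succ_of_lt h]
        · simp [h]
        · have : ¬ d k < r + 1 := by omega
          simp [h.ne', h.not_gt, this]
      have e0 : y r + ((0 : ℝ) : ℂ) • V = y r := by simp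
      simp only [e0, e1] at hbd
      refine le_of_eq_of_le ?_ (by simpa using hbd)
      congr 1
      ring
    · intro t ht
      refine (norm_sum_le _ _).trans (sum_le_sum fun j hj => ?_)
      have hj' : d j = r := by simpa using hj
      rw [norm_mul, hj']
      by_cases hv : v j = 0
      · have hnn : 0 ≤ ∑ k with d k ≤ r, ‖v k‖ ^ 2 := sum_nonneg fun _ _ => by positivity
        have := mul_nonneg (mul_nonneg zero_le_two (hK0 j)) hnn
        simpa [hv] using this
      have hL := norm_sub_le_of_bounded_polydisc (hq j hv) (hK j hv) hc (hin t ht.1 ht.2.le)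
      have hKj := hK0 j
      have h1 := hV2 j hj'
      have h2 := hdist t ht.1 ht.2.le
      set E := ∑ k with d k ≤ r, ‖v k‖ ^ 2
      calc _ ≤ ‖v j‖ * (2 * K j * ‖y r + (t : ℂ) • V - c‖) := by gcongr
        _ = 2 * K j * (‖v j‖ * ‖y r + (t : ℂ) • V - c‖) := by ring
        _ ≤ 2 * K j * E := by
          gcongr
          nlinarith [sq_nonneg (‖v j‖ - ‖y r + (t : ℂ) • V - c‖)]
  obtain ⟨N, hN⟩ : ∃ N, ∀ j, d j < N :=
    ⟨univ.sup d + 1, fun j => Nat.lt_succ_of_le (le_sup (mem_univ j))⟩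
  have h0 : y 0 = c := by funext k; simp [hy]
  have h1 : y N = c + v := by funext k; simp [hy, hN]
  have hsum : ∀ {M : Type} [AddCommMonoid M] (F : ι → M),
      ∑ j, F j = ∑ r ∈ range N, ∑ j with d j = r, F j := fun F =>
    (sum_fiberwise_of_maps_to (fun j _ => mem_range.2 (hN j)) F).symm
  rw [← h1, ← h0, ← sum_range_sub (fun r => g (y r)) N, h0, hsum, hsum, ← sum_sub_distrib]
  exact (norm_sum_le _ _).trans (sum_le_sum fun r _ => hstep r)

/-- Distance to the origin on the ring. -/
def ringDist {ℓ : ℕ} (j : Fin ℓ) : ℕ := min (j : ℕ) ((-j : Fin ℓ) : ℕ)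

theorem sum_ringDist_le {ℓ : ℕ} {f : ℕ → ℝ} (hf : ∀ n, 0 ≤ f n) (hs : Summable f) :
    ∑ j : Fin ℓ, f (ringDist j) ≤ 2 * ∑' n, f n := by
  have h1 : ∑ j : Fin ℓ, f (j : ℕ) ≤ ∑' n, f n := by
    rw [Fin.sum_univ_eq_sum_range]
    exact hs.sum_le_tsum _ fun n _ => hf n
  have h2 : ∑ j : Fin ℓ, f ((-j : Fin ℓ) : ℕ) ≤ ∑' n, f n :=
    (Equiv.sum_comp (Equiv.neg (Fin ℓ)) fun j => f (j : ℕ)).trans_le h1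
  calc ∑ j : Fin ℓ, f (ringDist j) ≤ ∑ j : Fin ℓ, (f (j : ℕ) + f ((-j : Fin ℓ) : ℕ)) := by
        refine sum_le_sum fun j _ => ?_
        rcases min_choice (j : ℕ) ((-j : Fin ℓ) : ℕ) with h | h <;>
          simp only [ringDist, h] <;> linarith [hf (j : ℕ), hf ((-j : Fin ℓ) : ℕ)]
    _ ≤ 2 * ∑' n, f n := by rw [sum_add_distrib]; linarith

theorem val_nsmul_one {ℓ : ℕ} [NeZero ℓ] (k : Fin ℓ) : (k : ℕ) • (1 : Fin ℓ) = k := by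
  have h : ∀ n : ℕ, n • (1 : Fin ℓ) = Fin.ofNat ℓ n := by
    intro n
    induction n with
    | zero => simp
    | succ n ih => rw [succ_nsmul, ih]; ext; simp [Fin.val_add]
  rw [h]; ext; simp

theorem sum_sq_sub_nsmul_le {ℓ : ℕ} [NeZero ℓ] (u : Fin ℓ → ℝ) (n : ℕ) :
    ∑ a, (u (a + n • 1) - u a) ^ 2 ≤ (n : ℝ) ^ 2 * ∑ a, (u a - u (a + 1)) ^ 2 := by
  have h1 : ∀ a, (u (a + n • 1) - u a) ^ 2
      ≤ n * ∑ p ∈ range n, (u (a + p • 1) - u (a + p • 1 + 1)) ^ 2 := by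
    intro a
    have h := sum_range_sub (fun p : ℕ => u (a + p • 1)) n
    simp only [zero_smul, add_zero] at h
    rw [← h]
    refine (sq_sum_le_card_mul_sum_sq).trans_eq ?_
    rw [card_range]
    congr 1
    refine sum_congr rfl fun p _ => ?_
    rw [succ_nsmul, ← add_assoc]
    ring
  calc _ ≤ ∑ a, n * ∑ p ∈ range n, (u (a + p • 1) - u (a + p • 1 + 1)) ^ 2 :=
        sum_le_sum fun a _ => h1 a
    _ = n * ∑ p ∈ range n, ∑ a, (u (a + p • 1) - u (a + p • 1 + 1)) ^ 2 := by
        rw [← mul_sum, sum_comm]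
    _ = n * ∑ p ∈ range n, ∑ a, (u a - u (a + 1)) ^ 2 := by
        congr 1
        refine sum_congr rfl fun p _ => ?_
        exact Equiv.sum_comp (Equiv.addRight (p • (1 : Fin ℓ))) fun a => (u a - u (a + 1)) ^ 2
    _ = _ := by rw [sum_const, card_range, nsmul_eq_mul]; ring

theorem sum_sq_sub_le {ℓ : ℕ} [NeZero ℓ] (u : Fin ℓ → ℝ) (k : Fin ℓ) :
    ∑ a, (u (a + k) - u a) ^ 2 ≤ (ringDist k : ℝ) ^ 2 * ∑ a, (u a - u (a + 1)) ^ 2 := by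
  rcases min_choice (k : ℕ) ((-k : Fin ℓ) : ℕ) with h | h
  · have := sum_sq_sub_nsmul_le u (k : ℕ)
    rw [val_nsmul_one] at this
    simpa only [ringDist, h] using this
  · have := sum_sq_sub_nsmul_le u ((-k : Fin ℓ) : ℕ)
    rw [val_nsmul_one, ← Equiv.sum_comp (Equiv.addRight k)] at this
    simp only [ringDist, h]
    refine le_of_eq_of_le (sum_congr rfl fun a _ => ?_) this
    simp only [Equiv.coe_addRight, add_neg_cancel_right]
    ring

/-- On a closed orbit the Riemann sum of a Lipschitz function is of second order, since the
exact increments of a primitive telescope. -/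
theorem norm_sum_mul_sub_le {ι : Type*} [Fintype ι] (e : Equiv.Perm ι) (u : ι → ℝ) {β : ℝ → ℂ}
    {L : ℝ} (hβ : ∀ x y, ‖β x - β y‖ ≤ L * |x - y|) :
    ‖∑ a, β (u a) * ((u (e a) - u a : ℝ) : ℂ)‖ ≤ L * ∑ a, (u (e a) - u a) ^ 2 := by
  have hL : 0 ≤ L := by
    have := (norm_nonneg _).trans (hβ 1 0)
    simpa using this
  have hcont : Continuous β := by
    refine (LipschitzWith.of_dist_le_mul (K := ⟨L, hL⟩) fun x y => ?_).continuous
    rw [dist_eq_norm, Real.dist_eq]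
    exact hβ x y
  set B : ℝ → ℂ := fun x => ∫ t in (0 : ℝ)..x, β t
  have hB : ∀ x y, ‖B y - B x - β x * ((y - x : ℝ) : ℂ)‖ ≤ L * (y - x) ^ 2 := by
    intro x y
    have hi : ∀ a b, IntervalIntegrable β MeasureTheory.volume a b := fun a b =>
      hcont.intervalIntegrable a b
    have h1 : B y - B x - β x * ((y - x : ℝ) : ℂ) = ∫ t in x..y, (β t - β x) := by
      rw [intervalIntegral.integral_interval_sub_left (hi _ _) (hi _ _),
        intervalIntegral.integral_sub (hi _ _) (by simp), intervalIntegral.integral_const]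
      rw [Complex.real_smul, mul_comm]
    rw [h1]
    refine (intervalIntegral.norm_integral_le_of_norm_le_const (C := L * |y - x|) ?_).trans_eq ?_
    · intro t ht
      refine (hβ t x).trans ?_
      refine mul_le_mul_of_nonneg_left ?_ hL
      exact Set.abs_sub_left_of_mem_uIcc (Set.uIoc_subset_uIcc ht)
    · rw [mul_assoc, ← sq, sq_abs]
  have h0 : ∑ a, (B (u (e a)) - B (u a)) = 0 := by
    rw [sum_sub_distrib, Equiv.sum_comp e fun a => B (u a), sub_self]
  have h2 : ∑ a, β (u a) * ((u (e a) - u a : ℝ) : ℂ)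
      = -∑ a, (B (u (e a)) - B (u a) - β (u a) * ((u (e a) - u a : ℝ) : ℂ)) := by
    rw [sum_sub_distrib, h0]; ring
  rw [h2, norm_neg, mul_sum]
  exact (norm_sum_le _ _).trans (sum_le_sum fun a _ => hB _ _)

theorem abs_clamp_sub_le (U x y : ℝ) : |max (-U) (min U x) - max (-U) (min U y)| ≤ |x - y| := by
  rw [max_comm, max_comm (-U)]
  exact (abs_max_sub_max_le_abs _ _ _).trans (by simpa using abs_min_sub_min_le_max U x U y)

/-- The sum over the ring of a translation covariant family of local functions differs from its
value on locally constant configurations by a multiple of the Dirichlet form. -/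
theorem exists_local_sum_bound : ∃ C : ℝ, 0 < C ∧ ∀ (ℓ : ℕ) [NeZero ℓ] (g : (Fin ℓ → ℂ) → ℂ)
    (K M L U : ℝ) (φ : ℝ → ℝ) (u : Fin ℓ → ℝ), 0 ≤ K → 0 ≤ L → 0 ≤ U → U ≤ 1 → (∀ a, |u a| ≤ U) →
    DifferentiableOn ℂ g (Metric.ball 0 2) →
    (∀ j, j ≠ 0 →
      DifferentiableOn ℂ (fun x => fderiv ℂ g x (Pi.single j 1)) (Metric.ball 0 2)) →
    (∀ j, j ≠ 0 → ∀ x ∈ Metric.ball (0 : Fin ℓ → ℂ) 2,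
      ‖fderiv ℂ g x (Pi.single j 1)‖ ≤ K * (1 / 4) ^ ringDist j) →
    (∀ x, |x| ≤ U → |φ x| ≤ M) →
    (∀ x y, |x| ≤ U → |y| ≤ U → |φ x - φ y| ≤ L * |x - y|) →
    ‖∑ a, (φ (u a) : ℂ) * (g (fun j => (u (a + j) : ℂ)) - g (fun _ => (u a : ℂ)))‖
      ≤ C * (M + L) * K * ∑ a, (u a - u (a + 1)) ^ 2 := by
  have hs0 : Summable fun n : ℕ => (1 / 2 : ℝ) ^ n := summable_geometric_two
  have hs2 : Summable fun n : ℕ => (n : ℝ) ^ 2 * (1 / 2 : ℝ) ^ n :=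
    summable_pow_mul_geometric_of_norm_lt_one 2 (by norm_num)
  set S0 := ∑' n : ℕ, (1 / 2 : ℝ) ^ n
  set S2 := ∑' n : ℕ, (n : ℝ) ^ 2 * (1 / 2 : ℝ) ^ n
  have hS0 : 0 ≤ S0 := tsum_nonneg fun n => by positivity
  have hS2 : 0 ≤ S2 := tsum_nonneg fun n => by positivity
  refine ⟨8 * S0 * S2 + 4 * S2 + 1, by positivity, ?_⟩
  intro ℓ _ g K M L U φ u hK hL hU0 hU1 hu hg hq hqK hφM hφL
  set Δ := ∑ a, (u a - u (a + 1)) ^ 2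
  have hΔ : 0 ≤ Δ := sum_nonneg fun _ _ => sq_nonneg _
  have hM : 0 ≤ M := (abs_nonneg _).trans (hφM 0 (by simpa using hU0))
  have hpow : ∀ n : ℕ, (1 / 4 : ℝ) ^ n = (1 / 2) ^ n * (1 / 2) ^ n := fun n => by
    rw [← mul_pow]; norm_num
  have hhalf : ∀ n : ℕ, (1 / 4 : ℝ) ^ n ≤ (1 / 2) ^ n := fun n =>
    pow_le_pow_left₀ (by norm_num) (by norm_num) n
  set q : Fin ℓ → ℝ → ℂ := fun j t => fderiv ℂ g (fun _ => (t : ℂ)) (Pi.single j 1) with hqdef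
  have hcn : ∀ t : ℝ, |t| ≤ U → ‖(fun _ => (t : ℂ) : Fin ℓ → ℂ)‖ ≤ 1 := by
    intro t ht
    rw [pi_norm_le_iff_of_nonneg zero_le_one]
    intro _
    rw [Complex.norm_real, Real.norm_eq_abs]
    linarith
  have hD : ∀ k : Fin ℓ, ∑ a, (u (a + k) - u a) ^ 2 ≤ (ringDist k : ℝ) ^ 2 * Δ := fun k =>
    sum_sq_sub_le u k
  have hterm : ∀ a, ‖g (fun j => (u (a + j) : ℂ)) - g (fun _ => (u a : ℂ))
      - ∑ j, ((u (a + j) - u a : ℝ) : ℂ) * q j (u a)‖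
      ≤ ∑ j : Fin ℓ, 2 * (K * (1 / 4) ^ ringDist j) *
        ∑ k : Fin ℓ with ringDist k ≤ ringDist j, (u (a + k) - u a) ^ 2 := by
    intro a
    have hv : ∀ j : Fin ℓ, ((u (a + j) - u a : ℝ) : ℂ) ≠ 0 → j ≠ 0 := by
      rintro j hj rfl
      simp at hj
    have h := norm_sub_sub_sum_le_of_shells (g := g) (K := fun j => K * (1 / 4) ^ ringDist j)
      (ringDist (ℓ := ℓ)) hg
      (v := fun j => ((u (a + j) - u a : ℝ) : ℂ)) (c := fun _ => (u a : ℂ))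
      (fun j hj => hq j (hv j hj)) (fun j hj => hqK j (hv j hj)) (fun j => by positivity)
      (hcn _ (hu a)) ?_
    · have e1 : ((fun _ => (u a : ℂ)) + fun j => ((u (a + j) - u a : ℝ) : ℂ))
          = fun j => (u (a + j) : ℂ) := by
        funext j; simp
      rw [e1] at h
      simpa only [Complex.norm_real, Real.norm_eq_abs, sq_abs] using h
    · rw [pi_norm_le_iff_of_nonneg zero_le_one]
      intro j
      simp only [Pi.add_apply, Complex.ofReal_sub, add_sub_cancel, Complex.norm_real,
        Real.norm_eq_abs]
      exact (hu _).trans hU1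
  have hsecond : ‖∑ a, (φ (u a) : ℂ) * (g (fun j => (u (a + j) : ℂ)) - g (fun _ => (u a : ℂ))
      - ∑ j, ((u (a + j) - u a : ℝ) : ℂ) * q j (u a))‖ ≤ 8 * S0 * S2 * M * K * Δ := by
    calc _ ≤ ∑ a, M * ∑ j : Fin ℓ, 2 * (K * (1 / 4) ^ ringDist j) *
          ∑ k : Fin ℓ with ringDist k ≤ ringDist j, (u (a + k) - u a) ^ 2 := by
          refine (norm_sum_le _ _).trans (sum_le_sum fun a _ => ?_)
          rw [norm_mul, Complex.norm_real]
          exact mul_le_mul (hφM _ (hu a)) (hterm a) (norm_nonneg _) hM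
      _ = M * ∑ j : Fin ℓ, 2 * (K * (1 / 4) ^ ringDist j) *
          ∑ k : Fin ℓ with ringDist k ≤ ringDist j, ∑ a, (u (a + k) - u a) ^ 2 := by
          rw [← mul_sum, sum_comm]
          congr 1
          refine sum_congr rfl fun j _ => ?_
          rw [← mul_sum, sum_comm]
      _ ≤ M * ∑ j : Fin ℓ, 2 * K * (1 / 2) ^ ringDist j *
          ∑ k : Fin ℓ, (ringDist k : ℝ) ^ 2 * (1 / 2) ^ ringDist k * Δ := by
          refine mul_le_mul_of_nonneg_left (sum_le_sum fun j _ => ?_) hM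
          rw [hpow, show 2 * (K * ((1 / 2 : ℝ) ^ ringDist j * (1 / 2) ^ ringDist j))
            = 2 * K * (1 / 2) ^ ringDist j * (1 / 2) ^ ringDist j by ring, mul_assoc _ _ (∑ k with _, _)]
          refine mul_le_mul_of_nonneg_left ?_ (by positivity)
          rw [mul_sum]
          refine (sum_le_sum fun k hk => ?_).trans (sum_le_sum_of_subset_of_nonneg
            (filter_subset _ _) fun k _ _ => by positivity)
          have hk' : ringDist k ≤ ringDist j := by simpa using hk
          calc (1 / 2 : ℝ) ^ ringDist j * ∑ a, (u (a + k) - u a) ^ 2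
              ≤ (1 / 2) ^ ringDist k * ((ringDist k : ℝ) ^ 2 * Δ) := by
                refine mul_le_mul ?_ (hD k) (sum_nonneg fun _ _ => sq_nonneg _) (by positivity)
                exact pow_le_pow_of_le_one (by norm_num) (by norm_num) hk'
            _ = _ := by ring
      _ = 2 * M * K * Δ * ((∑ j : Fin ℓ, (1 / 2) ^ ringDist j) *
          ∑ k : Fin ℓ, (ringDist k : ℝ) ^ 2 * (1 / 2) ^ ringDist k) := by
          rw [← sum_mul, ← mul_sum, ← sum_mul]; ring
      _ ≤ 2 * M * K * Δ * ((2 * S0) * (2 * S2)) := by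
          refine mul_le_mul_of_nonneg_left ?_ (by positivity)
          refine mul_le_mul (sum_ringDist_le (fun n => by positivity) hs0)
            (sum_ringDist_le (f := fun n : ℕ => (n : ℝ) ^ 2 * (1 / 2 : ℝ) ^ n)
              (fun n => by positivity) hs2) (sum_nonneg fun _ _ => by positivity) (by positivity)
      _ = _ := by ring
  have hfirst : ∀ j, ‖∑ a, (φ (u a) : ℂ) * (((u (a + j) - u a : ℝ) : ℂ) * q j (u a))‖
      ≤ (2 * M + L) * K * Δ * ((ringDist j : ℝ) ^ 2 * (1 / 2) ^ ringDist j) := by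
    intro j
    rcases eq_or_ne j 0 with rfl | hj
    · simp only [add_zero, sub_self, Complex.ofReal_zero, zero_mul, mul_zero, sum_const_zero,
        norm_zero]
      positivity
    set Kj := K * (1 / 4) ^ ringDist j with hKj
    have hKj0 : 0 ≤ Kj := by positivity
    set cl : ℝ → ℝ := fun t => max (-U) (min U t) with hcl
    have hclU : ∀ t, |cl t| ≤ U := by
      intro t
      rw [abs_le]
      exact ⟨le_max_left _ _, max_le (by linarith) (min_le_left _ _)⟩
    have hclu : ∀ a, cl (u a) = u a := by
      intro a
      have := abs_le.1 (hu a)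
      simp [hcl, this.1, this.2]
    have hqb : ∀ t, ‖q j (cl t)‖ ≤ Kj := by
      intro t
      refine hqK j hj _ ?_
      rw [mem_ball_zero_iff]
      linarith [hcn _ (hclU t)]
    have hqL : ∀ x y, ‖q j (cl x) - q j (cl y)‖ ≤ 2 * Kj * |x - y| := by
      intro x y
      refine (norm_sub_le_of_bounded_polydisc (hq j hj) (hqK j hj) (hcn _ (hclU y))
        (hcn _ (hclU x))).trans ?_
      refine mul_le_mul_of_nonneg_left ?_ (by positivity)
      rw [pi_norm_le_iff_of_nonneg (abs_nonneg _)]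
      intro _
      simp only [Pi.sub_apply, ← Complex.ofReal_sub, Complex.norm_real, Real.norm_eq_abs]
      exact abs_clamp_sub_le U x y
    have hβ : ∀ x y, ‖(φ (cl x) : ℂ) * q j (cl x) - (φ (cl y) : ℂ) * q j (cl y)‖
        ≤ (2 * M + L) * Kj * |x - y| := by
      intro x y
      have e : (φ (cl x) : ℂ) * q j (cl x) - (φ (cl y) : ℂ) * q j (cl y)
          = (φ (cl x) : ℂ) * (q j (cl x) - q j (cl y))
            + ((φ (cl x) - φ (cl y) : ℝ) : ℂ) * q j (cl y) := by
        push_cast; ring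
      rw [e]
      refine (norm_add_le _ _).trans ?_
      rw [norm_mul, norm_mul, Complex.norm_real, Complex.norm_real, Real.norm_eq_abs,
        Real.norm_eq_abs]
      have h1 := mul_le_mul (hφM _ (hclU x)) (hqL x y) (norm_nonneg _) hM
      have h2 : |φ (cl x) - φ (cl y)| ≤ L * |x - y| :=
        (hφL _ _ (hclU x) (hclU y)).trans
          (mul_le_mul_of_nonneg_left (abs_clamp_sub_le U x y) hL)
      have h3 := mul_le_mul h2 (hqb y) (norm_nonneg _) (by positivity)
      nlinarith [h1, h3]
    have h := norm_sum_mul_sub_le (Equiv.addRight j) u hβ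
    simp only [hclu, Equiv.coe_addRight] at h
    calc _ = ‖∑ a, (φ (u a) : ℂ) * q j (u a) * ((u (a + j) - u a : ℝ) : ℂ)‖ := by
          congr 1; exact sum_congr rfl fun a _ => by ring
      _ ≤ (2 * M + L) * Kj * ∑ a, (u (a + j) - u a) ^ 2 := h
      _ ≤ (2 * M + L) * (K * (1 / 2) ^ ringDist j) * ((ringDist j : ℝ) ^ 2 * Δ) := by
          have h1 : Kj ≤ K * (1 / 2) ^ ringDist j := mul_le_mul_of_nonneg_left (hhalf _) hK
          have h2 := hD j
          have h3 : 0 ≤ ∑ a, (u (a + j) - u a) ^ 2 := sum_nonneg fun _ _ => sq_nonneg _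
          gcongr
      _ = _ := by ring
  have hsplit : ∑ a, (φ (u a) : ℂ) * (g (fun j => (u (a + j) : ℂ)) - g (fun _ => (u a : ℂ)))
      = ∑ a, (φ (u a) : ℂ) * (g (fun j => (u (a + j) : ℂ)) - g (fun _ => (u a : ℂ))
          - ∑ j, ((u (a + j) - u a : ℝ) : ℂ) * q j (u a))
        + ∑ j, ∑ a, (φ (u a) : ℂ) * (((u (a + j) - u a : ℝ) : ℂ) * q j (u a)) := by
    rw [sum_comm, ← sum_add_distrib]
    refine sum_congr rfl fun a _ => ?_
    rw [← mul_sum]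
    ring
  have hfirst' : ‖∑ j, ∑ a, (φ (u a) : ℂ) * (((u (a + j) - u a : ℝ) : ℂ) * q j (u a))‖
      ≤ (2 * M + L) * K * Δ * (2 * S2) := by
    refine (norm_sum_le _ _).trans ((sum_le_sum fun j _ => hfirst j).trans ?_)
    rw [← mul_sum]
    exact mul_le_mul_of_nonneg_left (sum_ringDist_le
      (f := fun n : ℕ => (n : ℝ) ^ 2 * (1 / 2 : ℝ) ^ n) (fun n => by positivity) hs2)
      (by positivity)
  rw [hsplit]
  refine (norm_add_le _ _).trans ((add_le_add hsecond hfirst').trans ?_)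
  have h1 : 0 ≤ M * K * Δ := by positivity
  have h2 : 0 ≤ L * K * Δ := by positivity
  have h3 := mul_nonneg (mul_nonneg hS0 hS2) h2
  have h4 := mul_nonneg hS2 h2
  nlinarith

/-- One site transfer matrix of the ring in the basis adapted to the bond interaction. -/
def siteMatrix {R : Type*} [CommRing R] (s x : R) : Matrix (Fin 2) (Fin 2) R :=
  !![1, s * x; s * x, s ^ 2]

/-- Product of the transfer matrices along a chain. -/
def chainMatrix {R : Type*} [CommRing R] (s : R) (l : List R) : Matrix (Fin 2) (Fin 2) R :=
  (l.map (siteMatrix s)).prod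

/-- The normalised partition function of the ring as a function of `u i = tanh (h i)`. -/
def ringTrace {R : Type*} [CommRing R] {ℓ : ℕ} (s : R) (u : Fin ℓ → R) : R :=
  (chainMatrix s (List.ofFn u)).trace

theorem prod_ofFn_apply {R ι : Type*} [CommRing R] [Fintype ι] [DecidableEq ι] (n : ℕ)
    (M : Fin (n + 1) → Matrix ι ι R) (a b : ι) :
    (List.ofFn M).prod a b = ∑ σ : Fin n → ι,
      ∏ i, M i ((Fin.cons a σ : Fin (n + 1) → ι) i) ((Fin.snoc σ b : Fin (n + 1) → ι) i) := by
  induction n generalizing a with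
  | zero => simp [Fin.snoc]
  | succ n ih =>
    rw [List.ofFn_succ, List.prod_cons, Matrix.mul_apply,
      ← (Fin.consEquiv fun _ : Fin (n + 1) => ι).sum_comp, Fintype.sum_prod_type]
    refine sum_congr rfl fun c _ => ?_
    rw [ih, mul_sum]
    refine sum_congr rfl fun σ _ => ?_
    rw [show (Fin.consEquiv fun _ : Fin (n + 1) => ι) (c, σ) = Fin.cons c σ from rfl, Fin.prod_univ_succ (n := n + 1)]
    have h : (Fin.snoc (Fin.cons c σ : Fin (n + 1) → ι) b : Fin (n + 2) → ι)
        = Fin.cons c (Fin.snoc σ b : Fin (n + 1) → ι) := (Fin.cons_snoc_eq_snoc_cons c σ b).symm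
    simp only [h, Fin.cons_zero, Fin.cons_succ]

theorem trace_prod_ofFn {R ι : Type*} [CommRing R] [Fintype ι] [DecidableEq ι] {ℓ : ℕ} [NeZero ℓ]
    (M : Fin ℓ → Matrix ι ι R) :
    (List.ofFn M).prod.trace = ∑ σ : Fin ℓ → ι, ∏ i, M i (σ i) (σ (i + 1)) := by
  obtain ⟨n, rfl⟩ := Nat.exists_eq_succ_of_ne_zero (NeZero.ne ℓ)
  rw [← (Fin.consEquiv fun _ : Fin (n + 1) => ι).sum_comp, Fintype.sum_prod_type, Matrix.trace]
  refine sum_congr rfl fun a _ => ?_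
  rw [Matrix.diag_apply, prod_ofFn_apply]
  refine sum_congr rfl fun σ _ => prod_congr rfl fun i _ => ?_
  simp only [Fin.consEquiv_apply]
  congr 1
  induction i using Fin.lastCases with
  | last => simp
  | cast i => rw [Fin.snoc_castSucc, Fin.coeSucc_eq_succ, Fin.cons_succ]

theorem ringTrace_eq_sum {R : Type*} [CommRing R] {ℓ : ℕ} [NeZero ℓ] (s : R) (u : Fin ℓ → R) :
    ringTrace s u = ∑ σ : Fin ℓ → Fin 2, ∏ i, siteMatrix s (u i) (σ i) (σ (i + 1)) := by
  rw [ringTrace, chainMatrix, List.map_ofFn, trace_prod_ofFn]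
  rfl

theorem ringTrace_shift {R : Type*} [CommRing R] {ℓ : ℕ} [NeZero ℓ] (s : R) (u : Fin ℓ → R)
    (a : Fin ℓ) : ringTrace s (fun j => u (a + j)) = ringTrace s u := by
  rw [ringTrace_eq_sum, ringTrace_eq_sum,
    ← (Equiv.arrowCongr (Equiv.addLeft a).symm (Equiv.refl (Fin 2))).sum_comp]
  refine sum_congr rfl fun σ _ => ?_
  rw [← Equiv.prod_comp (Equiv.addLeft a) fun i => siteMatrix s (u i) (σ i) (σ (i + 1))]
  refine prod_congr rfl fun i _ => ?_
  simp [Equiv.arrowCongr, add_assoc]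

theorem map_ringTrace {R S : Type*} [CommRing R] [CommRing S] {ℓ : ℕ} [NeZero ℓ] (f : R →+* S)
    (s : R) (u : Fin ℓ → R) : ringTrace (f s) (fun i => f (u i)) = f (ringTrace s u) := by
  have h : ∀ x a b, siteMatrix (f s) (f x) a b = f (siteMatrix s x a b) := by
    intro x a b
    fin_cases a <;> fin_cases b <;> simp [siteMatrix]
  simp only [ringTrace_eq_sum, map_sum, map_prod, h]

theorem siteMatrix_affine {R : Type*} [CommRing R] (s x : R) :
    siteMatrix s x = siteMatrix s 0 + x • (siteMatrix s 1 - siteMatrix s 0) := by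
  ext a b
  fin_cases a <;> fin_cases b <;> simp [siteMatrix, mul_comm]

theorem ofFn_update {α : Type*} {ℓ : ℕ} (u : Fin ℓ → α) (j : Fin ℓ) (t : α) :
    List.ofFn (Function.update u j t)
      = (List.ofFn u).take j ++ t :: (List.ofFn u).drop (j + 1) := by
  have h : List.ofFn (Function.update u j t) = (List.ofFn u).set j t := by
    refine List.ext_getElem (by simp) fun n h1 h2 => ?_
    rw [List.getElem_set]
    simp only [List.getElem_ofFn, Function.update_apply, Fin.ext_iff]
    simp only [eq_comm]
  rw [h, List.set_eq_take_append_cons_drop]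
  simp

/-- The ring trace is affine in each variable. -/
theorem ringTrace_update {R : Type*} [CommRing R] {ℓ : ℕ} (s : R) (u : Fin ℓ → R) (j : Fin ℓ)
    (t : R) : ringTrace s (Function.update u j t) = ringTrace s (Function.update u j 0)
      + t * (ringTrace s (Function.update u j 1) - ringTrace s (Function.update u j 0)) := by
  simp only [ringTrace, chainMatrix, ofFn_update, List.map_append, List.map_cons, List.prod_append,
    List.prod_cons]
  rw [siteMatrix_affine s t]
  simp only [Matrix.mul_add, Matrix.add_mul, Matrix.mul_sub, Matrix.sub_mul, Matrix.trace_add,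
    Matrix.trace_sub, Matrix.smul_mul, Matrix.mul_smul, Matrix.trace_smul, smul_eq_mul]

/-- The ring trace in terms of the two arcs between the origin and another site. -/
theorem exists_ringTrace_update_update {R : Type*} [CommRing R] {ℓ : ℕ} [NeZero ℓ] (s : R)
    (u : Fin ℓ → R) {j : Fin ℓ} (hj : j ≠ 0) : ∃ l₁ l₂ : List R,
      (∀ x ∈ l₁, ∃ i, x = u i) ∧ (∀ x ∈ l₂, ∃ i, x = u i) ∧
      l₁.length + 1 = (j : ℕ) ∧ l₂.length + 1 = ((-j : Fin ℓ) : ℕ) ∧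
      ∀ x y, ringTrace s (Function.update (Function.update u 0 x) j y)
        = (siteMatrix s x * chainMatrix s l₁ * siteMatrix s y * chainMatrix s l₂).trace := by
  obtain ⟨n, rfl⟩ := Nat.exists_eq_succ_of_ne_zero (NeZero.ne ℓ)
  obtain ⟨k, rfl⟩ := Fin.exists_succ_eq.2 hj
  refine ⟨(List.ofFn (Fin.tail u)).take k, (List.ofFn (Fin.tail u)).drop (k + 1), ?_, ?_, ?_, ?_,
    ?_⟩
  · intro x hx
    obtain ⟨i, rfl⟩ := List.mem_ofFn.1 (List.mem_of_mem_take hx)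
    exact ⟨_, rfl⟩
  · intro x hx
    obtain ⟨i, rfl⟩ := List.mem_ofFn.1 (List.mem_of_mem_drop hx)
    exact ⟨_, rfl⟩
  · simp
  · simp [Fin.val_neg]
    omega
  · intro x y
    have h0 : List.ofFn (Function.update u 0 x) = x :: List.ofFn (Fin.tail u) := by
      rw [ofFn_update, List.ofFn_succ]
      simp
      rfl
    rw [ringTrace, ofFn_update, h0]
    simp [chainMatrix, Matrix.mul_assoc]

theorem mul_prod_map_mul_eq {R α m n : Type*} [CommRing R] [Fintype m] [Fintype n] [DecidableEq m]
    [DecidableEq n] (A : α → Matrix m n R) (B : Matrix n m R) (l : List α) :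
    B * (l.map fun x => A x * B).prod = (l.map fun x => B * A x).prod * B := by
  induction l with
  | nil => simp
  | cons x l ih =>
    rw [List.map_cons, List.map_cons, List.prod_cons, List.prod_cons, Matrix.mul_assoc (A x) B, ih]
    simp only [Matrix.mul_assoc]

theorem trace_prod_map_mul_comm {R α m n : Type*} [CommRing R] [Fintype m] [Fintype n]
    [DecidableEq m] [DecidableEq n] (A : α → Matrix m n R) (B : Matrix n m R) {l : List α}
    (hl : l ≠ []) :
    (l.map fun x => A x * B).prod.trace = (l.map fun x => B * A x).prod.trace := by
  cases l with
  | nil => exact absurd rfl hl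
  | cons x l =>
    rw [List.map_cons, List.map_cons, List.prod_cons, List.prod_cons, Matrix.mul_assoc (A x) B,
      mul_prod_map_mul_eq, ← Matrix.mul_assoc, Matrix.trace_mul_comm]
    simp only [Matrix.mul_assoc]

/-- The partition function factorises into free spins, bonds and the ring trace. -/
theorem Z_eq {ℓ : ℕ} [NeZero ℓ] {lam s : ℝ} (hs : s ^ 2 = Real.tanh lam) (h : Fin ℓ → ℝ) :
    Z lam h = (∏ i, (Real.exp (h i) + Real.exp (-(h i)))) * Real.cosh lam ^ ℓ
      * ringTrace s (u h) := by
  set F : Matrix ℤˣ (Fin 2) ℝ := Matrix.of fun σ k => if k = 0 then 1 else s * ((σ : ℤ) : ℝ) with hF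
  set A : ℝ → Matrix ℤˣ (Fin 2) ℝ := fun x =>
    Matrix.of fun σ k => (1 + x * ((σ : ℤ) : ℝ)) / 2 * F σ k with hA
  have hunits : ∀ f : ℤˣ → ℝ, ∑ σ, f σ = f 1 + f (-1) := fun f => by
    rw [show (univ : Finset ℤˣ) = {1, -1} from rfl, sum_pair (by decide)]
  have hN : ∀ x, siteMatrix s x = F.transpose * A x := by
    intro x
    ext a b
    rw [Matrix.mul_apply, hunits]
    fin_cases a <;> fin_cases b <;> simp [siteMatrix, hF, hA] <;> ring
  have hl : List.ofFn (u h) ≠ [] := by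
    rw [Ne, List.ofFn_eq_nil_iff]
    exact NeZero.ne ℓ
  have h1 : ringTrace s (u h) = ∑ σ : Fin ℓ → ℤˣ, ∏ i, (A (u h i) * F.transpose) (σ i) (σ (i + 1)) := by
    rw [ringTrace, chainMatrix, show siteMatrix s = fun x => F.transpose * A x from funext hN,
      ← trace_prod_map_mul_comm _ _ hl, List.map_ofFn, trace_prod_ofFn]
    rfl
  have hc := Real.cosh_pos lam
  have hbond : ∀ σ τ : ℤˣ, Real.exp (lam * ((σ : ℤ) : ℝ) * ((τ : ℤ) : ℝ))
      = Real.cosh lam * ∑ k, F σ k * F τ k := by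
    intro σ τ
    have e1 : Real.cosh lam * (1 + s ^ 2) = Real.exp lam := by
      rw [hs, Real.tanh_eq_sinh_div_cosh, ← Real.cosh_add_sinh]; field_simp
    have e2 : Real.cosh lam * (1 - s ^ 2) = Real.exp (-lam) := by
      rw [hs, Real.tanh_eq_sinh_div_cosh, ← Real.cosh_sub_sinh]; field_simp
    rcases Int.units_eq_one_or σ with rfl | rfl <;> rcases Int.units_eq_one_or τ with rfl | rfl <;>
      simp [← e1, ← e2, hF, -mul_eq_mul_left_iff] <;> ring
  have hfield : ∀ (x : ℝ) (σ : ℤˣ), Real.exp (x * ((σ : ℤ) : ℝ))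
      = (Real.exp x + Real.exp (-x)) * ((1 + Real.tanh x * ((σ : ℤ) : ℝ)) / 2) := by
    intro x σ
    have e0 : Real.exp x + Real.exp (-x) = 2 * Real.cosh x := by rw [Real.cosh_eq]; ring
    have hx := Real.cosh_pos x
    rw [e0, Real.tanh_eq_sinh_div_cosh]
    rcases Int.units_eq_one_or σ with rfl | rfl
    · simp [← Real.cosh_add_sinh]; field_simp
    · simp [← Real.cosh_sub_sinh]; field_simp; ring
  rw [Z, h1, mul_sum]
  refine sum_congr rfl fun σ _ => ?_
  rw [Real.exp_sum, ← Fin.prod_const, ← prod_mul_distrib, ← prod_mul_distrib]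
  refine prod_congr rfl fun i _ => ?_
  rw [Real.exp_add, hbond, hfield, Matrix.mul_apply]
  simp only [hA, Matrix.of_apply, Matrix.transpose_apply, u, mul_sum, sum_mul]
  refine sum_congr rfl fun k _ => ?_
  ring

theorem siteMatrix_transpose {R : Type*} [CommRing R] (s x : R) :
    (siteMatrix s x).transpose = siteMatrix s x := by
  ext a b
  fin_cases a <;> fin_cases b <;> rfl

theorem chainMatrix_cons {R : Type*} [CommRing R] (s x : R) (l : List R) :
    chainMatrix s (x :: l) = siteMatrix s x * chainMatrix s l := by
  simp [chainMatrix]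

theorem chainMatrix_reverse {R : Type*} [CommRing R] (s : R) (l : List R) :
    chainMatrix s l.reverse = (chainMatrix s l).transpose := by
  simp only [chainMatrix, Matrix.transpose_list_prod, List.map_map, List.map_reverse]
  congr 2
  exact List.map_congr_left fun x _ => (siteMatrix_transpose s x).symm

/-- The transfer matrices preserve a cone around the first basis vector. -/
theorem chainMatrix_cone {s : ℝ} (hs : 0 ≤ s) (hs1 : s ^ 2 ≤ 1 / 1000) (l : List ℂ)
    (hl : ∀ x ∈ l, ‖x‖ ≤ 2) :
    chainMatrix (s : ℂ) l 0 0 ≠ 0 ∧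
    ‖chainMatrix (s : ℂ) l 1 0‖ ≤ 4 * s * ‖chainMatrix (s : ℂ) l 0 0‖ ∧
    ‖(chainMatrix (s : ℂ) l).det‖ ≤ (8 * s ^ 2) ^ l.length * ‖chainMatrix (s : ℂ) l 0 0‖ ^ 2 := by
  induction l with
  | nil => simp [chainMatrix]; exact hs
  | cons x l ih =>
    obtain ⟨h0, h1, h2⟩ := ih fun y hy => hl y (List.mem_cons_of_mem _ hy)
    have hx : ‖x‖ ≤ 2 := hl x List.mem_cons_self
    rw [chainMatrix_cons, Matrix.det_mul]
    set A := chainMatrix (s : ℂ) l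
    have e0 : (siteMatrix (s : ℂ) x * A) 0 0 = A 0 0 + s * x * A 1 0 := by
      simp [siteMatrix, Matrix.mul_apply]
    have e1 : (siteMatrix (s : ℂ) x * A) 1 0 = s * x * A 0 0 + s ^ 2 * A 1 0 := by
      simp [siteMatrix, Matrix.mul_apply]
    have e2 : (siteMatrix (s : ℂ) x).det = s ^ 2 * (1 - x ^ 2) := by
      simp [siteMatrix, Matrix.det_fin_two]; ring
    have hsn : ‖(s : ℂ)‖ = s := by rw [Complex.norm_real, Real.norm_of_nonneg hs]
    have hpos : 0 < ‖A 0 0‖ := norm_pos_iff.2 h0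
    have hsx : ‖(s : ℂ) * x‖ ≤ 2 * s := by rw [norm_mul, hsn]; nlinarith
    have hb : ‖(s : ℂ) * x * A 1 0‖ ≤ 8 * s ^ 2 * ‖A 0 0‖ := by
      rw [norm_mul]
      calc _ ≤ 2 * s * (4 * s * ‖A 0 0‖) := by gcongr
        _ = _ := by ring
    have hlow : (1 - 8 * s ^ 2) * ‖A 0 0‖ ≤ ‖A 0 0 + s * x * A 1 0‖ := by
      have := norm_sub_le (A 0 0 + s * x * A 1 0) (s * x * A 1 0)
      rw [add_sub_cancel_right] at this
      linarith
    have hlow' : (99 / 100) * ‖A 0 0‖ ≤ ‖A 0 0 + s * x * A 1 0‖ := by nlinarith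
    rw [e0, e1, e2]
    refine ⟨?_, ?_, ?_⟩
    · rw [← norm_pos_iff]; linarith
    · have h3 : ‖(s : ℂ) * x * A 0 0‖ ≤ 2 * s * ‖A 0 0‖ := by
        rw [norm_mul]; gcongr
      have h4 : ‖(s : ℂ) ^ 2 * A 1 0‖ ≤ s ^ 2 * (4 * s * ‖A 0 0‖) := by
        rw [norm_mul, norm_pow, hsn]; gcongr
      have h5 := norm_add_le ((s : ℂ) * x * A 0 0) ((s : ℂ) ^ 2 * A 1 0)
      have h6 : s ^ 2 * (4 * s * ‖A 0 0‖) ≤ 1 / 1000 * (4 * s * ‖A 0 0‖) := by gcongr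
      have h7 : 4 * s * ((99 / 100) * ‖A 0 0‖) ≤ 4 * s * ‖A 0 0 + s * x * A 1 0‖ := by gcongr
      have h8 : 0 ≤ s * ‖A 0 0‖ := by positivity
      linarith
    · have h3 : ‖1 - x ^ 2‖ ≤ 5 := by
        refine (norm_sub_le _ _).trans ?_
        rw [norm_pow, norm_one]
        nlinarith [norm_nonneg x]
      have h4 : ‖A 0 0‖ ^ 2 ≤ 8 / 5 * ‖A 0 0 + s * x * A 1 0‖ ^ 2 := by nlinarith
      rw [norm_mul, norm_mul, norm_pow, hsn, List.length_cons, pow_succ]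
      calc s ^ 2 * ‖1 - x ^ 2‖ * ‖A.det‖
          ≤ s ^ 2 * 5 * ((8 * s ^ 2) ^ l.length * (8 / 5 * ‖A 0 0 + s * x * A 1 0‖ ^ 2)) := by
            gcongr
            exact h2.trans (by gcongr)
        _ = _ := by ring

/-- Normal form of the transfer matrix of a chain. -/
theorem exists_chainMatrix_eq {s : ℝ} (hs : 0 ≤ s) (hs1 : s ^ 2 ≤ 1 / 1000) (l : List ℂ)
    (hl : ∀ x ∈ l, ‖x‖ ≤ 2) : ∃ a β γ δ : ℂ, a ≠ 0 ∧
      chainMatrix (s : ℂ) l = a • !![1, β; γ, β * γ + δ] ∧ ‖β‖ ≤ 4 * s ∧ ‖γ‖ ≤ 4 * s ∧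
      ‖δ‖ ≤ (8 * s ^ 2) ^ l.length ∧ (l.length = 0 → δ = 1) := by
  obtain ⟨h0, h1, h2⟩ := chainMatrix_cone hs hs1 l hl
  obtain ⟨-, h3, -⟩ := chainMatrix_cone hs hs1 l.reverse fun x hx => hl x (List.mem_reverse.1 hx)
  rw [chainMatrix_reverse] at h3
  simp only [Matrix.transpose_apply] at h3
  have hpos := norm_pos_iff.2 h0
  refine ⟨chainMatrix (s : ℂ) l 0 0, chainMatrix (s : ℂ) l 0 1 / chainMatrix (s : ℂ) l 0 0,
    chainMatrix (s : ℂ) l 1 0 / chainMatrix (s : ℂ) l 0 0,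
    (chainMatrix (s : ℂ) l).det / chainMatrix (s : ℂ) l 0 0 ^ 2, h0, ?_, ?_, ?_, ?_, ?_⟩
  · rw [Matrix.det_fin_two]
    ext a b
    fin_cases a <;> fin_cases b <;> simp <;> field_simp
    ring
  · rwa [norm_div, div_le_iff₀ hpos]
  · rwa [norm_div, div_le_iff₀ hpos]
  · rwa [norm_div, norm_pow, div_le_iff₀ (by positivity)]
  · intro hl0
    rw [List.length_eq_zero_iff.1 hl0]
    simp [chainMatrix]

theorem ringTrace_ne_zero {s : ℝ} (hs : 0 ≤ s) (hs1 : s ^ 2 ≤ 1 / 1000) {ℓ : ℕ} [NeZero ℓ]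
    {u : Fin ℓ → ℂ} (hu : ∀ i, ‖u i‖ ≤ 2) : ringTrace (s : ℂ) u ≠ 0 := by
  obtain ⟨a, β, γ, δ, ha, hA, hβ, hγ, hδ, -⟩ := exists_chainMatrix_eq hs hs1 (List.ofFn u) (by
    intro x hx
    obtain ⟨i, rfl⟩ := List.mem_ofFn.1 hx
    exact hu i)
  have e : ringTrace (s : ℂ) u = a * (1 + (β * γ + δ)) := by
    rw [ringTrace, hA, Matrix.trace_fin_two]
    simp; ring
  rw [e]
  refine mul_ne_zero ha fun h => ?_
  have h1 : ‖β * γ + δ‖ = 1 := by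
    rw [show β * γ + δ = -1 by linear_combination h, norm_neg, norm_one]
  have h2 : ‖β * γ + δ‖ ≤ 4 * s * (4 * s) + (8 * s ^ 2) ^ (List.ofFn u).length :=
    norm_add_le_of_le (norm_mul_le_of_le hβ hγ) hδ
  have h3 : (8 * s ^ 2) ^ (List.ofFn u).length ≤ 8 * s ^ 2 :=
    pow_le_of_le_one (by positivity) (by linarith) (by simpa using NeZero.ne ℓ)
  nlinarith

/-- Logarithmic derivative of the ring trace in the variable at the origin. -/
def logDerivZero {𝕜 : Type*} [Field 𝕜] {ℓ : ℕ} [NeZero ℓ] (s : 𝕜) (u : Fin ℓ → 𝕜) : 𝕜 :=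
  (ringTrace s (Function.update u 0 1) - ringTrace s (Function.update u 0 0)) / ringTrace s u

theorem contDiff_ringTrace {𝕜 : Type*} [RCLike 𝕜] {ℓ : ℕ} [NeZero ℓ] (s : 𝕜) {n : WithTop ℕ∞} :
    ContDiff 𝕜 n (fun u : Fin ℓ → 𝕜 => ringTrace s u) := by
  have h : ∀ a b, ContDiff 𝕜 n fun x : 𝕜 => siteMatrix s x a b := by
    intro a b
    fin_cases a <;> fin_cases b <;> simp [siteMatrix] <;> fun_prop
  simp only [ringTrace_eq_sum]
  exact ContDiff.sum fun σ _ => contDiff_prod fun i _ => (h _ _).comp (contDiff_apply 𝕜 𝕜 i)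

theorem contDiffOn_logDerivZero {s : ℝ} (hs : 0 ≤ s) (hs1 : s ^ 2 ≤ 1 / 1000) {ℓ : ℕ} [NeZero ℓ]
    {n : WithTop ℕ∞} :
    ContDiffOn ℂ n (logDerivZero (ℓ := ℓ) (s : ℂ)) (Metric.ball 0 2) := by
  have h : ∀ t : ℂ, ContDiff ℂ n fun u : Fin ℓ → ℂ => Function.update u 0 t := by
    intro t
    rw [contDiff_pi]
    intro i
    by_cases hi : i = 0
    · simp only [hi, Function.update_self]; exact contDiff_const
    · simp only [Function.update_of_ne hi]; exact contDiff_apply ℂ ℂ i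
  refine ContDiffOn.div ?_ (contDiff_ringTrace _).contDiffOn ?_
  · exact (((contDiff_ringTrace _).comp (h 1)).sub ((contDiff_ringTrace _).comp (h 0))).contDiffOn
  · intro u hu
    refine ringTrace_ne_zero hs hs1 fun i => (norm_le_pi_norm u i).trans ?_
    rw [mem_ball_zero_iff] at hu
    exact hu.le

/-- Size of the logarithmic derivative and of its own derivatives: the latter are, to leading
order, the relative determinants of the two arcs joining the origin to the other site. -/
theorem logDerivZero_bounds {s : ℝ} (hs : 0 ≤ s) (hs1 : s ^ 2 ≤ 1 / 1000) {ℓ : ℕ} [NeZero ℓ]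
    {u : Fin ℓ → ℂ} (hu : u ∈ Metric.ball (0 : Fin ℓ → ℂ) 2) {j : Fin ℓ} (hj : j ≠ 0) :
    ‖logDerivZero (s : ℂ) u‖ ≤ 40 * s ^ 2 ∧ ∃ (δ₁ δ₂ : ℂ) (n₁ n₂ : ℕ),
      n₁ + 1 = (j : ℕ) ∧ n₂ + 1 = ((-j : Fin ℓ) : ℕ) ∧ ‖δ₁‖ ≤ (8 * s ^ 2) ^ n₁ ∧
      ‖δ₂‖ ≤ (8 * s ^ 2) ^ n₂ ∧ (n₁ = 0 → δ₁ = 1) ∧ (n₂ = 0 → δ₂ = 1) ∧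
      ‖fderiv ℂ (logDerivZero (s : ℂ)) u (Pi.single j 1) - s ^ 2 * (δ₁ + δ₂)‖
        ≤ 200 * (s ^ 2) ^ 2 * (‖δ₁‖ + ‖δ₂‖) := by
  have hui : ∀ i, ‖u i‖ ≤ 2 := fun i => (norm_le_pi_norm u i).trans (by
    rw [mem_ball_zero_iff] at hu
    exact hu.le)
  obtain ⟨l₁, l₂, hl₁, hl₂, hn₁, hn₂, htr⟩ := exists_ringTrace_update_update (s : ℂ) u hj
  obtain ⟨a, β, γ, δ, ha, hA, hβ, hγ, hδ, hδ1⟩ := exists_chainMatrix_eq hs hs1 l₁ (by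
    intro x hx
    obtain ⟨i, rfl⟩ := hl₁ x hx
    exact hui i)
  obtain ⟨a', β', γ', δ', ha', hA', hβ', hγ', hδ', hδ1'⟩ := exists_chainMatrix_eq hs hs1 l₂ (by
    intro x hx
    obtain ⟨i, rfl⟩ := hl₂ x hx
    exact hui i)
  set t : ℝ := s ^ 2 with ht
  have ht0 : 0 ≤ t := by positivity
  have hsn : ‖(s : ℂ)‖ = s := by rw [Complex.norm_real, Real.norm_of_nonneg hs]
  have htn : ‖(s : ℂ) ^ 2‖ = t := by rw [norm_pow, hsn]
  have hδ2 : ‖δ‖ ≤ 1 := hδ.trans (pow_le_one₀ (by positivity) (by linarith))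
  have hδ2' : ‖δ'‖ ≤ 1 := hδ'.trans (pow_le_one₀ (by positivity) (by linarith))
  set e := β * γ + δ with he
  set e' := β' * γ' + δ' with he'
  have hee : ‖e‖ ≤ 2 := by
    have : ‖e‖ ≤ 4 * s * (4 * s) + 1 := norm_add_le_of_le (norm_mul_le_of_le hβ hγ) hδ2
    nlinarith
  have hee' : ‖e'‖ ≤ 2 := by
    have : ‖e'‖ ≤ 4 * s * (4 * s) + 1 := norm_add_le_of_le (norm_mul_le_of_le hβ' hγ') hδ2'
    nlinarith
  set p00 : ℂ := 1 + s ^ 2 * (β * γ' + γ * β') + (s ^ 2) ^ 2 * (e * e') with hp00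
  set p10 : ℂ := s * (γ + β' + s ^ 2 * (e * γ' + β * e')) with hp10
  set p01 : ℂ := s * (β + γ' + s ^ 2 * (e * β' + γ * e')) with hp01
  set p11 : ℂ := s ^ 2 * (e + e' + (γ * γ' + β * β')) with hp11
  have hP : ∀ x y, ringTrace (s : ℂ) (Function.update (Function.update u 0 x) j y)
      = a * a' * (p00 + x * p10 + y * p01 + x * y * p11) := by
    intro x y
    rw [htr, hA, hA', Matrix.trace_fin_two]
    simp only [siteMatrix, Matrix.mul_apply, Fin.sum_univ_two, Matrix.smul_apply, smul_eq_mul,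
      Matrix.of_apply, Matrix.cons_val', Matrix.cons_val_zero, Matrix.cons_val_one,
      Matrix.cons_val_fin_one, hp00, hp10, hp01, hp11]
    ring
  have hQ : p11 * p00 - p10 * p01 = s ^ 2 *
      (δ * (1 - s ^ 2 * (β' * β' + γ' * γ') + (s ^ 2) ^ 2 * (e' * e'))
        + δ' * (1 - s ^ 2 * (β * β + γ * γ) + (s ^ 2) ^ 2 * (e * e))) := by
    rw [hp00, hp10, hp01, hp11, he, he']; ring
  have b00 : ‖p00 - 1‖ ≤ t := by
    have h1 : ‖(s : ℂ) ^ 2 * (β * γ' + γ * β')‖ ≤ t * (4 * s * (4 * s) + 4 * s * (4 * s)) :=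
      norm_mul_le_of_le htn.le (norm_add_le_of_le (norm_mul_le_of_le hβ hγ')
        (norm_mul_le_of_le hγ hβ'))
    have h2 : ‖((s : ℂ) ^ 2) ^ 2 * (e * e')‖ ≤ t ^ 2 * (2 * 2) :=
      norm_mul_le_of_le (by rw [norm_pow, htn]) (norm_mul_le_of_le hee hee')
    rw [show p00 - 1 = s ^ 2 * (β * γ' + γ * β') + (s ^ 2) ^ 2 * (e * e') by rw [hp00]; ring]
    refine (norm_add_le_of_le h1 h2).trans ?_
    nlinarith
  have b1 : ∀ b c b' c' : ℂ, ‖b‖ ≤ 4 * s → ‖c‖ ≤ 4 * s → ‖b'‖ ≤ 4 * s → ‖c'‖ ≤ 4 * s →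
      ‖(s : ℂ) * (c + b' + s ^ 2 * (e * c' + b * e'))‖ ≤ 9 * t := by
    intro b c b' c' hb hc hb' hc'
    have h : ‖(s : ℂ) * (c + b' + s ^ 2 * (e * c' + b * e'))‖
        ≤ s * (4 * s + 4 * s + t * (2 * (4 * s) + 4 * s * 2)) :=
      norm_mul_le_of_le hsn.le (norm_add_le_of_le (norm_add_le_of_le hc hb')
        (norm_mul_le_of_le htn.le (norm_add_le_of_le (norm_mul_le_of_le hee hc')
          (norm_mul_le_of_le hb hee'))))
    refine h.trans ?_
    nlinarith
  have b10 : ‖p10‖ ≤ 9 * t := b1 β γ β' γ' hβ hγ hβ' hγ'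
  have b01 : ‖p01‖ ≤ 9 * t := b1 γ β γ' β' hγ hβ hγ' hβ'
  have b11 : ‖p11‖ ≤ 5 * t := by
    have h : ‖p11‖ ≤ t * (2 + 2 + (4 * s * (4 * s) + 4 * s * (4 * s))) :=
      norm_mul_le_of_le htn.le (norm_add_le_of_le (norm_add_le_of_le hee hee')
        (norm_add_le_of_le (norm_mul_le_of_le hγ hγ') (norm_mul_le_of_le hβ hβ')))
    refine h.trans ?_
    nlinarith
  set x := u 0
  set y := u j
  have hx : ‖x‖ ≤ 2 := hui 0
  have hy : ‖y‖ ≤ 2 := hui j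
  set p := p00 + x * p10 + y * p01 + x * y * p11 with hp
  have bp : ‖p - 1‖ ≤ 60 * t := by
    rw [show p - 1 = p00 - 1 + x * p10 + y * p01 + x * y * p11 by rw [hp]; ring]
    refine (norm_add_le_of_le (norm_add_le_of_le (norm_add_le_of_le b00
      (norm_mul_le_of_le hx b10)) (norm_mul_le_of_le hy b01))
      (norm_mul_le_of_le (norm_mul_le_of_le hx hy) b11)).trans ?_
    linarith
  have hplow : 94 / 100 ≤ ‖p‖ := by
    have h := norm_sub_le p (p - 1)
    rw [sub_sub_cancel, norm_one] at h
    linarith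
  have hp0 : p ≠ 0 := norm_pos_iff.1 (by linarith)
  have hw : ∀ z, logDerivZero (s : ℂ) (Function.update u j z)
      = (p10 + z * p11) / (p00 + x * p10 + z * p01 + x * z * p11) := by
    intro z
    have h1 : ∀ r, Function.update (Function.update u j z) 0 r
        = Function.update (Function.update u 0 r) j z := fun r =>
      Function.update_comm hj _ _ _
    have h2 : Function.update u j z = Function.update (Function.update u 0 x) j z := by
      rw [Function.update_eq_self]
    rw [logDerivZero, h1, h1, hP, hP, h2, hP, ← mul_sub, mul_div_mul_left _ _ (mul_ne_zero ha ha')]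
    ring_nf
  have huy : Function.update u j y = u := Function.update_eq_self _ _
  have hwu : logDerivZero (s : ℂ) u = (p10 + y * p11) / p := by
    rw [← hw y, huy]
  have hfd : fderiv ℂ (logDerivZero (s : ℂ)) u (Pi.single j 1) = (p11 * p00 - p10 * p01) / p ^ 2 := by
    have hd : HasFDerivAt (logDerivZero (s : ℂ)) (fderiv ℂ (logDerivZero (s : ℂ)) u)
        (Function.update u j y) := by
      rw [huy]
      exact (((contDiffOn_logDerivZero (n := 1) hs hs1).differentiableOn one_ne_zero _
        hu).differentiableAt (Metric.isOpen_ball.mem_nhds hu)).hasFDerivAt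
    have h1 := hd.comp_hasDerivAt y (hasDerivAt_update u j y)
    have h2 : HasDerivAt (fun z => (p10 + z * p11) / (p00 + x * p10 + z * p01 + x * z * p11))
        ((p11 * p - (p10 + y * p11) * (p01 + x * p11)) / p ^ 2) y := by
      have hn : HasDerivAt (fun z => p10 + z * p11) p11 y := by
        simpa using ((hasDerivAt_id y).mul_const p11).const_add p10
      have hden : HasDerivAt (fun z => p00 + x * p10 + z * p01 + x * z * p11) (p01 + x * p11) y := by
        exact ((((hasDerivAt_id y).mul_const p01).const_add (p00 + x * p10)).add
          (((hasDerivAt_id y).const_mul x).mul_const p11)).congr_deriv (by simp)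
      exact hn.div hden hp0
    have h3 := h1.unique (h2.congr_of_eventuallyEq (Filter.Eventually.of_forall hw))
    rw [h3, hp]
    congr 1
    ring
  refine ⟨?_, δ, δ', l₁.length, l₂.length, hn₁, hn₂, hδ, hδ', hδ1, hδ1', ?_⟩
  · rw [hwu, norm_div, div_le_iff₀ (by linarith)]
    have := norm_add_le_of_le b10 (norm_mul_le_of_le hy b11)
    nlinarith
  · have hT : ∀ b c f : ℂ, ‖b‖ ≤ 4 * s → ‖c‖ ≤ 4 * s → ‖f‖ ≤ 2 →
        ‖1 - (s : ℂ) ^ 2 * (b * b + c * c) + ((s : ℂ) ^ 2) ^ 2 * (f * f) - p ^ 2‖ ≤ 150 * t := by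
      intro b c f hb hc hf
      rw [show 1 - (s : ℂ) ^ 2 * (b * b + c * c) + ((s : ℂ) ^ 2) ^ 2 * (f * f) - p ^ 2
        = ((s : ℂ) ^ 2) ^ 2 * (f * f) - (s : ℂ) ^ 2 * (b * b + c * c)
          - ((p - 1) * (p - 1) + 2 * (p - 1)) by ring]
      have h1 : ‖((s : ℂ) ^ 2) ^ 2 * (f * f)‖ ≤ t ^ 2 * (2 * 2) :=
        norm_mul_le_of_le (by rw [norm_pow, htn]) (norm_mul_le_of_le hf hf)
      have h2 : ‖(s : ℂ) ^ 2 * (b * b + c * c)‖ ≤ t * (4 * s * (4 * s) + 4 * s * (4 * s)) :=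
        norm_mul_le_of_le htn.le (norm_add_le_of_le (norm_mul_le_of_le hb hb)
          (norm_mul_le_of_le hc hc))
      have h3 : ‖(p - 1) * (p - 1) + 2 * (p - 1)‖ ≤ 60 * t * (60 * t) + 2 * (60 * t) :=
        norm_add_le_of_le (norm_mul_le_of_le bp bp) (norm_mul_le_of_le (by simp) bp)
      have h4 := norm_sub_le_of_le (norm_sub_le_of_le h1 h2) h3
      refine h4.trans ?_
      nlinarith
    have hp2 : p ^ 2 ≠ 0 := pow_ne_zero 2 hp0
    rw [hfd, hQ, div_sub' hp2, norm_div, div_le_iff₀ (norm_pos_iff.2 hp2), norm_pow]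
    rw [show (s : ℂ) ^ 2 * (δ * (1 - s ^ 2 * (β' * β' + γ' * γ') + (s ^ 2) ^ 2 * (e' * e'))
        + δ' * (1 - s ^ 2 * (β * β + γ * γ) + (s ^ 2) ^ 2 * (e * e)))
        - p ^ 2 * (s ^ 2 * (δ + δ')) = (s : ℂ) ^ 2 *
      (δ * (1 - s ^ 2 * (β' * β' + γ' * γ') + (s ^ 2) ^ 2 * (e' * e') - p ^ 2)
        + δ' * (1 - s ^ 2 * (β * β + γ * γ) + (s ^ 2) ^ 2 * (e * e) - p ^ 2)) by ring]
    have h1 := norm_mul_le_of_le htn.le (norm_add_le_of_le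
      (norm_mul_le_of_le le_rfl (hT β' γ' e' hβ' hγ' hee') : ‖δ * _‖ ≤ ‖δ‖ * _)
      (norm_mul_le_of_le le_rfl (hT β γ e hβ hγ hee) : ‖δ' * _‖ ≤ ‖δ'‖ * _))
    refine h1.trans ?_
    have h2 : 150 / 200 ≤ ‖p‖ ^ 2 := by nlinarith
    calc _ = 200 * t ^ 2 * (‖δ‖ + ‖δ'‖) * (150 / 200) := by ring
      _ ≤ _ := by gcongr

theorem hasDerivAt_tanh (x : ℝ) : HasDerivAt Real.tanh (1 - Real.tanh x ^ 2) x := by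
  have hc := Real.cosh_pos x
  have h := (Real.hasDerivAt_sinh x).div (Real.hasDerivAt_cosh x) hc.ne'
  have e : Real.tanh = Real.sinh / Real.cosh := by
    funext y; rw [Real.tanh_eq_sinh_div_cosh]; rfl
  rw [e]
  refine h.congr_deriv ?_
  simp only [Pi.div_apply]
  field_simp

theorem monotone_tanh : Monotone Real.tanh := by
  refine monotone_of_deriv_nonneg (fun x => (hasDerivAt_tanh x).differentiableAt) fun x => ?_
  rw [(hasDerivAt_tanh x).deriv]
  linarith [Real.tanh_sq_lt_one x]

theorem tanh_bounds {lam : ℝ} (h0 : 0 ≤ lam) :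
    0 ≤ Real.tanh lam ∧ Real.tanh lam ≤ lam ∧ lam - lam ^ 2 ≤ Real.tanh lam := by
  have hc := Real.cosh_pos lam
  have hsinh : lam ≤ Real.sinh lam := Real.self_le_sinh_iff.2 h0
  have hle : Real.tanh lam ≤ lam := by
    have hmono : Monotone fun x => x - Real.tanh x := by
      refine monotone_of_deriv_nonneg (fun x => ?_) fun x => ?_
      · exact ((hasDerivAt_id x).sub (hasDerivAt_tanh x)).differentiableAt
      · refine le_of_le_of_eq ?_ ((hasDerivAt_id' x).sub (hasDerivAt_tanh x)).deriv.symm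
        nlinarith [sq_nonneg (Real.tanh x)]
    have := hmono h0
    simpa using this
  refine ⟨?_, hle, ?_⟩
  · rw [Real.tanh_eq_sinh_div_cosh]
    exact div_nonneg (h0.trans hsinh) hc.le
  · have h1 : Real.cosh lam ≤ Real.exp lam := by
      rw [← Real.cosh_add_sinh]; linarith
    have h2 : (1 - lam) * Real.exp lam ≤ 1 := by
      have h3 := Real.add_one_le_exp (-lam)
      have h4 : Real.exp (-lam) * Real.exp lam = 1 := by rw [← Real.exp_add]; simp
      nlinarith [Real.exp_pos lam]
    rw [Real.tanh_eq_sinh_div_cosh, le_div_iff₀ hc]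
    rcases le_or_gt lam 1 with h5 | h5
    · have : (1 - lam) * Real.cosh lam ≤ 1 := by nlinarith
      nlinarith
    · have : (lam - lam ^ 2) * Real.cosh lam ≤ 0 :=
        mul_nonpos_of_nonpos_of_nonneg (by nlinarith) hc.le
      linarith

/-- `w₀` with its leading part `lam * (u 1 + u (-1))` removed. -/
def logDerivRem {𝕜 : Type*} [Field 𝕜] {ℓ : ℕ} [NeZero ℓ] (s lam : 𝕜) (u : Fin ℓ → 𝕜) : 𝕜 :=
  logDerivZero s u - lam * (u 1 + u (-1))

theorem one_eq_iff_val_eq_one {ℓ : ℕ} [NeZero ℓ] {j : Fin ℓ} (hj : j ≠ 0) :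
    1 = j ↔ (j : ℕ) = 1 := by
  obtain ⟨n, rfl⟩ := Nat.exists_eq_succ_of_ne_zero (NeZero.ne ℓ)
  cases n with
  | zero => exact absurd (Subsingleton.elim _ _) hj
  | succ n => rw [Fin.ext_iff, eq_comm]; simp

theorem pow_le_ringDist {x : ℝ} (hx0 : 0 ≤ x) (hx : x ≤ 1 / 4) {n d : ℕ} (hd : d ≤ n + 1) :
    x ^ n ≤ 4 * (1 / 4) ^ d := by
  calc x ^ n ≤ (1 / 4) ^ n := pow_le_pow_left₀ hx0 hx n
    _ = 4 * (1 / 4) ^ (n + 1) := by rw [pow_succ]; ring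
    _ ≤ 4 * (1 / 4) ^ d := by
      gcongr 4 * ?_
      exact pow_le_pow_of_le_one (by norm_num) (by norm_num) hd

theorem norm_fderiv_logDerivZero_le {s : ℝ} (hs : 0 ≤ s) (hs1 : s ^ 2 ≤ 1 / 1000) {ℓ : ℕ} [NeZero ℓ]
    {u : Fin ℓ → ℂ} (hu : u ∈ Metric.ball (0 : Fin ℓ → ℂ) 2) {j : Fin ℓ} (hj : j ≠ 0) :
    ‖fderiv ℂ (logDerivZero (s : ℂ)) u (Pi.single j 1)‖ ≤ 16 * s ^ 2 * (1 / 4) ^ ringDist j := by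
  obtain ⟨-, δ₁, δ₂, n₁, n₂, h1, h2, hδ₁, hδ₂, -, -, h⟩ := logDerivZero_bounds hs hs1 hu hj
  have ht0 : 0 ≤ s ^ 2 := by positivity
  have b1 := hδ₁.trans (pow_le_ringDist (d := ringDist j) (by positivity) (by linarith)
    ((min_le_left _ _).trans_eq h1.symm))
  have b2 := hδ₂.trans (pow_le_ringDist (d := ringDist j) (by positivity) (by linarith)
    ((min_le_right _ _).trans_eq h2.symm))
  have htn : ‖(s : ℂ) ^ 2 * (δ₁ + δ₂)‖ ≤ s ^ 2 * (‖δ₁‖ + ‖δ₂‖) :=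
    norm_mul_le_of_le (by rw [norm_pow, Complex.norm_real, Real.norm_of_nonneg hs])
      (norm_add_le _ _)
  have h3 := norm_add_le_of_le h htn
  rw [sub_add_cancel] at h3
  refine h3.trans ?_
  have h4 : 200 * (s ^ 2) ^ 2 ≤ s ^ 2 := by nlinarith
  have h5 : 0 ≤ ‖δ₁‖ + ‖δ₂‖ := by positivity
  calc _ ≤ s ^ 2 * (‖δ₁‖ + ‖δ₂‖) + s ^ 2 * (‖δ₁‖ + ‖δ₂‖) := by gcongr
    _ ≤ s ^ 2 * (4 * (1 / 4) ^ ringDist j + 4 * (1 / 4) ^ ringDist j)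
        + s ^ 2 * (4 * (1 / 4) ^ ringDist j + 4 * (1 / 4) ^ ringDist j) := by gcongr
    _ = _ := by ring

theorem norm_mul_sub_ite_le {s lam : ℝ} (hs1 : s ^ 2 ≤ 1 / 1000) (hlam : 0 ≤ lam)
    (hst : s ^ 2 = Real.tanh lam) {δ : ℂ} {n d : ℕ} (hδ : ‖δ‖ ≤ (8 * s ^ 2) ^ n)
    (hδ1 : n = 0 → δ = 1) (hd : d ≤ n + 1) :
    ‖(s : ℂ) ^ 2 * δ - if n + 1 = 1 then (lam : ℂ) else 0‖ ≤ 128 * lam ^ 2 * (1 / 4) ^ d := by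
  obtain ⟨h0, h1, h2⟩ := tanh_bounds hlam
  rw [← hst] at h0 h1 h2
  cases n with
  | zero =>
    rw [hδ1 rfl]
    have e : (s : ℂ) ^ 2 * 1 - (if 0 + 1 = 1 then (lam : ℂ) else 0) = ((s ^ 2 - lam : ℝ) : ℂ) := by
      simp
    rw [e, Complex.norm_real, Real.norm_eq_abs, abs_sub_comm, abs_of_nonneg (by linarith)]
    have h3 : (1 / 4 : ℝ) ^ 1 ≤ (1 / 4) ^ d :=
      pow_le_pow_of_le_one (by norm_num) (by norm_num) (by simpa using hd)
    nlinarith [sq_nonneg lam]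
  | succ n =>
    have e : ¬ n + 1 + 1 = 1 := by omega
    have hsn : ‖(s : ℂ) ^ 2‖ = s ^ 2 := by
      rw [← Complex.ofReal_pow, Complex.norm_real, Real.norm_of_nonneg h0]
    rw [if_neg e, sub_zero, norm_mul, hsn]
    have h3 : (8 * s ^ 2) ^ n ≤ 16 * (1 / 4) ^ d := by
      calc (8 * s ^ 2) ^ n ≤ (1 / 4) ^ n := pow_le_pow_left₀ (by positivity) (by linarith) n
        _ = 16 * (1 / 4) ^ (n + 1 + 1) := by rw [pow_succ, pow_succ]; ring
        _ ≤ 16 * (1 / 4) ^ d := by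
          gcongr 16 * ?_
          exact pow_le_pow_of_le_one (by norm_num) (by norm_num) hd
    calc s ^ 2 * ‖δ‖ ≤ lam * (16 * (1 / 4) ^ d * (8 * lam)) := by
          gcongr
          rw [pow_succ] at hδ
          refine hδ.trans ?_
          gcongr
      _ = _ := by ring

theorem norm_fderiv_logDerivRem_le {s lam : ℝ} (hs : 0 ≤ s) (hs1 : s ^ 2 ≤ 1 / 1000)
    (hlam : 0 ≤ lam) (hst : s ^ 2 = Real.tanh lam) {ℓ : ℕ} [NeZero ℓ]
    {u : Fin ℓ → ℂ} (hu : u ∈ Metric.ball (0 : Fin ℓ → ℂ) 2) {j : Fin ℓ} (hj : j ≠ 0) :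
    ‖fderiv ℂ (logDerivRem (s : ℂ) lam) u (Pi.single j 1)‖
      ≤ 2000 * lam ^ 2 * (1 / 4) ^ ringDist j := by
  obtain ⟨-, δ₁, δ₂, n₁, n₂, h1, h2, hδ₁, hδ₂, hδ₁', hδ₂', h⟩ := logDerivZero_bounds hs hs1 hu hj
  have hd1 : ringDist j ≤ n₁ + 1 := (min_le_left _ _).trans_eq h1.symm
  have hd2 : ringDist j ≤ n₂ + 1 := (min_le_right _ _).trans_eq h2.symm
  have b1 := hδ₁.trans (pow_le_ringDist (d := ringDist j) (by positivity) (by linarith) hd1)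
  have b2 := hδ₂.trans (pow_le_ringDist (d := ringDist j) (by positivity) (by linarith) hd2)
  have c1 := norm_mul_sub_ite_le hs1 hlam hst hδ₁ hδ₁' hd1
  have c2 := norm_mul_sub_ite_le hs1 hlam hst hδ₂ hδ₂' hd2
  obtain ⟨h0, hle, -⟩ := tanh_bounds hlam
  rw [← hst] at h0 hle
  have hd : HasFDerivAt (logDerivZero (ℓ := ℓ) (s : ℂ)) (fderiv ℂ (logDerivZero (s : ℂ)) u) u :=
    (((contDiffOn_logDerivZero (n := 1) hs hs1).differentiableOn one_ne_zero _
      hu).differentiableAt (Metric.isOpen_ball.mem_nhds hu)).hasFDerivAt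
  have hl := ((hasFDerivAt_apply (𝕜 := ℂ) (1 : Fin ℓ) u).add
    (hasFDerivAt_apply (𝕜 := ℂ) (-1 : Fin ℓ) u)).const_mul (lam : ℂ)
  have hf := (hd.sub hl).fderiv
  have hneg : (-1 = j) ↔ 1 = -j := neg_eq_iff_eq_neg
  have hval : fderiv ℂ (logDerivRem (s : ℂ) lam) u (Pi.single j 1)
      = (fderiv ℂ (logDerivZero (s : ℂ)) u (Pi.single j 1) - s ^ 2 * (δ₁ + δ₂))
        + (((s : ℂ) ^ 2 * δ₁ - if n₁ + 1 = 1 then (lam : ℂ) else 0)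
          + ((s : ℂ) ^ 2 * δ₂ - if n₂ + 1 = 1 then (lam : ℂ) else 0)) := by
    have : fderiv ℂ (logDerivRem (s : ℂ) lam) u (Pi.single j 1)
        = fderiv ℂ (logDerivZero (s : ℂ)) u (Pi.single j 1)
          - lam * ((if 1 = j then 1 else 0) + (if -1 = j then 1 else 0)) := by
      refine (DFunLike.congr_fun hf (Pi.single j 1)).trans ?_
      simp [Pi.single_apply, mul_add]
    simp only [this, h1, h2, hneg, one_eq_iff_val_eq_one hj,
      one_eq_iff_val_eq_one (neg_ne_zero.2 hj)]
    split_ifs <;> ring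
  rw [hval]
  refine (norm_add_le_of_le h (norm_add_le_of_le c1 c2)).trans ?_
  have h5 : (s ^ 2) ^ 2 ≤ lam ^ 2 := pow_le_pow_left₀ h0 hle 2
  calc _ ≤ 200 * lam ^ 2 * (4 * (1 / 4) ^ ringDist j + 4 * (1 / 4) ^ ringDist j)
        + (128 * lam ^ 2 * (1 / 4) ^ ringDist j + 128 * lam ^ 2 * (1 / 4) ^ ringDist j) := by
        gcongr
    _ ≤ _ := by
        have : 0 ≤ lam ^ 2 * (1 / 4) ^ ringDist j := by positivity
        linarith

theorem ofReal_logDerivZero {ℓ : ℕ} [NeZero ℓ] (s : ℝ) (u : Fin ℓ → ℝ) :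
    logDerivZero (s : ℂ) (fun i => (u i : ℂ)) = (logDerivZero s u : ℝ) := by
  have h : ∀ v : Fin ℓ → ℝ, ringTrace (s : ℂ) (fun i => (v i : ℂ)) = (ringTrace s v : ℝ) :=
    fun v => map_ringTrace Complex.ofRealHom s v
  have h2 : ∀ t : ℝ, Function.update (fun i => (u i : ℂ)) 0 (t : ℂ)
      = fun i => ((Function.update u 0 t i : ℝ) : ℂ) := by
    intro t
    funext i
    by_cases hi : i = 0 <;> simp [hi]
  have e1 := h2 1
  have e0 := h2 0
  push_cast at e1 e0
  rw [logDerivZero, logDerivZero, e1, e0, h, h, h]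
  push_cast
  rfl

theorem ofReal_logDerivRem {ℓ : ℕ} [NeZero ℓ] (s lam : ℝ) (u : Fin ℓ → ℝ) :
    logDerivRem (s : ℂ) (lam : ℂ) (fun i => (u i : ℂ)) = (logDerivRem s lam u : ℝ) := by
  rw [logDerivRem, logDerivRem, ofReal_logDerivZero]
  push_cast
  rfl

theorem differentiableOn_fderiv_apply {E : Type*} [NormedAddCommGroup E] [NormedSpace ℂ E]
    {g : E → ℂ} {r : ℝ} (hg : ContDiffOn ℂ 2 g (Metric.ball 0 r)) (v : E) :
    DifferentiableOn ℂ (fun x => fderiv ℂ g x v) (Metric.ball 0 r) := by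
  have := (hg.fderiv_of_isOpen (m := 1) Metric.isOpen_ball (by norm_num)).differentiableOn
    one_ne_zero
  exact this.clm_apply (differentiableOn_const v)

/-- Local sums built from the remainder `logDerivRem` and from the square of `logDerivZero`. -/
theorem exists_logDeriv_sum_bounds : ∃ C : ℝ, 0 < C ∧ ∀ (ℓ : ℕ) [NeZero ℓ]
    (s lam M L U : ℝ) (φ : ℝ → ℝ) (u : Fin ℓ → ℝ), 0 ≤ s → 0 ≤ lam → lam ≤ 1 / 1000 →
    s ^ 2 = Real.tanh lam → 0 ≤ L → 0 ≤ U → U ≤ 1 → (∀ a, |u a| ≤ U) →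
    (∀ x, |x| ≤ U → |φ x| ≤ M) →
    (∀ x y, |x| ≤ U → |y| ≤ U → |φ x - φ y| ≤ L * |x - y|) →
    |∑ a, φ (u a) * (logDerivRem s lam (fun j => u (a + j)) - logDerivRem s lam (fun _ : Fin ℓ => u a))|
      ≤ C * (M + L) * lam ^ 2 * ∑ a, (u a - u (a + 1)) ^ 2 ∧
    |∑ a, φ (u a) * (logDerivZero s (fun j => u (a + j)) ^ 2 - logDerivZero s (fun _ : Fin ℓ => u a) ^ 2)|
      ≤ C * (M + L) * lam ^ 2 * ∑ a, (u a - u (a + 1)) ^ 2 := by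
  obtain ⟨C, hC, hmain⟩ := exists_local_sum_bound
  refine ⟨2000 * C, by positivity, ?_⟩
  intro ℓ _ s lam M L U φ u hs hlam hlam1 hst hL hU0 hU1 hu hφM hφL
  obtain ⟨h0, hle, -⟩ := tanh_bounds hlam
  rw [← hst] at h0 hle
  have hs1 : s ^ 2 ≤ 1 / 1000 := hle.trans hlam1
  have hw : ContDiffOn ℂ 2 (logDerivZero (ℓ := ℓ) (s : ℂ)) (Metric.ball 0 2) :=
    contDiffOn_logDerivZero hs hs1
  constructor
  · have hV : ContDiffOn ℂ 2 (logDerivRem (ℓ := ℓ) (s : ℂ) (lam : ℂ)) (Metric.ball 0 2) := by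
      refine hw.sub (ContDiff.contDiffOn ?_)
      exact contDiff_const.mul ((contDiff_apply ℂ ℂ _).add (contDiff_apply ℂ ℂ _))
    have h := hmain ℓ _ (2000 * lam ^ 2) M L U φ u (by positivity) hL hU0 hU1 hu
      (hV.differentiableOn two_ne_zero) (fun j _ => differentiableOn_fderiv_apply hV _)
      (fun j hj x hx => norm_fderiv_logDerivRem_le hs hs1 hlam hst hx hj) hφM hφL
    have hcast1 := fun a : Fin ℓ => ofReal_logDerivRem s lam fun j => u (a + j)
    have hcast2 := fun a : Fin ℓ => ofReal_logDerivRem s lam fun _ : Fin ℓ => u a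
    simp only [hcast1, hcast2,
      ← Complex.ofReal_sub, ← Complex.ofReal_mul, ← Complex.ofReal_sum, Complex.norm_real,
      Real.norm_eq_abs] at h
    refine h.trans_eq ?_
    ring
  · have hW : ContDiffOn ℂ 2 (fun v => logDerivZero (ℓ := ℓ) (s : ℂ) v ^ 2) (Metric.ball 0 2) :=
      hw.pow 2
    have hK : ∀ j : Fin ℓ, j ≠ 0 → ∀ x ∈ Metric.ball (0 : Fin ℓ → ℂ) 2,
        ‖fderiv ℂ (fun v => logDerivZero (ℓ := ℓ) (s : ℂ) v ^ 2) x (Pi.single j 1)‖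
          ≤ 2000 * lam ^ 2 * (1 / 4) ^ ringDist j := by
      intro j hj x hx
      have hd : HasFDerivAt (logDerivZero (ℓ := ℓ) (s : ℂ)) (fderiv ℂ (logDerivZero (s : ℂ)) x) x :=
        ((hw.differentiableOn two_ne_zero _
          hx).differentiableAt (Metric.isOpen_ball.mem_nhds hx)).hasFDerivAt
      rw [(hd.pow 2).fderiv]
      have h1 := (logDerivZero_bounds hs hs1 hx hj).1
      have h2 := norm_fderiv_logDerivZero_le hs hs1 hx hj
      have h3 : ‖((2 : ℂ) * logDerivZero (s : ℂ) x) * fderiv ℂ (logDerivZero (s : ℂ)) x (Pi.single j 1)‖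
          ≤ 2 * (40 * s ^ 2) * (16 * s ^ 2 * (1 / 4) ^ ringDist j) :=
        norm_mul_le_of_le (norm_mul_le_of_le (by simp) h1) h2
      have h5 : (s ^ 2) ^ 2 ≤ lam ^ 2 := pow_le_pow_left₀ h0 hle 2
      calc _ = ‖((2 : ℂ) * logDerivZero (s : ℂ) x)
              * fderiv ℂ (logDerivZero (s : ℂ)) x (Pi.single j 1)‖ := by
            simp
        _ ≤ 1280 * (s ^ 2) ^ 2 * (1 / 4) ^ ringDist j := h3.trans_eq (by ring)
        _ ≤ 2000 * lam ^ 2 * (1 / 4) ^ ringDist j := by gcongr; norm_num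
    have h := hmain ℓ _ (2000 * lam ^ 2) M L U φ u (by positivity) hL hU0 hU1 hu
      (hW.differentiableOn two_ne_zero) (fun j _ => differentiableOn_fderiv_apply hW _)
      hK hφM hφL
    have hcast1 := fun a : Fin ℓ => ofReal_logDerivZero s fun j => u (a + j)
    have hcast2 := fun a : Fin ℓ => ofReal_logDerivZero s fun _ : Fin ℓ => u a
    simp only [hcast1, hcast2,
      ← Complex.ofReal_pow, ← Complex.ofReal_sub, ← Complex.ofReal_mul, ← Complex.ofReal_sum,
      Complex.norm_real, Real.norm_eq_abs] at h
    refine h.trans_eq ?_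
    ring

theorem hasDerivAt_artanh {x : ℝ} (hx : x ∈ Set.Ioo (-1 : ℝ) 1) :
    HasDerivAt Real.artanh (1 / (1 - x ^ 2)) x := by
  have h1 : 0 < 1 + x := by linarith [hx.1]
  have h2 : 0 < 1 - x := by linarith [hx.2]
  have hd : HasDerivAt (fun y : ℝ => 1 / 2 * Real.log ((1 + y) / (1 - y))) (1 / (1 - x ^ 2)) x := by
    have h3 := ((hasDerivAt_id' x).const_add 1).fun_div ((hasDerivAt_id' x).const_sub 1) h2.ne'
    refine ((h3.log (div_pos h1 h2).ne').const_mul (1 / 2)).congr_deriv ?_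
    have h4 : 1 - x ^ 2 = (1 - x) * (1 + x) := by ring
    rw [h4]
    field_simp
    ring
  refine hd.congr_of_eventuallyEq ?_
  filter_upwards [Ioo_mem_nhds hx.1 hx.2] with y hy
  exact Real.artanh_eq_half_log (Set.Ioo_subset_Icc_self hy)

theorem ringTrace_pos {ℓ : ℕ} [NeZero ℓ] {lam s : ℝ} (hs : s ^ 2 = Real.tanh lam) {v : Fin ℓ → ℝ}
    (hv : ∀ i, |v i| < 1) : 0 < ringTrace s v := by
  have hu : u (fun i => Real.artanh (v i)) = v := by
    funext i
    exact Real.tanh_artanh (abs_lt.1 (hv i))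
  have h := Z_eq hs fun i => Real.artanh (v i)
  rw [hu] at h
  have hZ : 0 < Z lam fun i => Real.artanh (v i) :=
    sum_pos (fun σ _ => Real.exp_pos _) univ_nonempty
  have hp : 0 < (∏ i, (Real.exp (Real.artanh (v i)) + Real.exp (-(Real.artanh (v i)))))
      * Real.cosh lam ^ ℓ :=
    mul_pos (prod_pos fun i _ => by positivity) (pow_pos (Real.cosh_pos _) _)
  rw [h] at hZ
  exact (pos_iff_pos_of_mul_pos hZ).1 hp

theorem ringTrace_update_shift {R : Type*} [CommRing R] {ℓ : ℕ} [NeZero ℓ] (s : R) (v : Fin ℓ → R)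
    (a : Fin ℓ) (t : R) : ringTrace s (Function.update (fun j => v (a + j)) 0 t)
      = ringTrace s (Function.update v a t) := by
  rw [← ringTrace_shift s (Function.update v a t) a]
  congr 1
  funext j
  simp [Function.update_apply]

theorem logDerivZero_shift {𝕜 : Type*} [Field 𝕜] {ℓ : ℕ} [NeZero ℓ] (s : 𝕜) (v : Fin ℓ → 𝕜)
    (a : Fin ℓ) : logDerivZero s (fun j => v (a + j))
      = (ringTrace s (Function.update v a 1) - ringTrace s (Function.update v a 0))
        / ringTrace s v := by
  rw [logDerivZero, ringTrace_update_shift, ringTrace_update_shift, ringTrace_shift]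

theorem hasDerivAt_ringTrace_update {ℓ : ℕ} [NeZero ℓ] (s : ℝ) (v : Fin ℓ → ℝ) (a : Fin ℓ)
    (t : ℝ) : HasDerivAt (fun t => ringTrace s (Function.update v a t))
      (ringTrace s (Function.update v a 1) - ringTrace s (Function.update v a 0)) t := by
  have h : (fun t => ringTrace s (Function.update v a t))
      = fun t => ringTrace s (Function.update v a 0)
        + t * (ringTrace s (Function.update v a 1) - ringTrace s (Function.update v a 0)) :=
    funext fun t => ringTrace_update s v a t
  rw [h]
  simpa using ((hasDerivAt_id t).mul_const (ringTrace s (Function.update v a 1)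
    - ringTrace s (Function.update v a 0))).const_add (ringTrace s (Function.update v a 0))

/-- The magnetization in terms of the ring trace. -/
theorem m_eq {ℓ : ℕ} [NeZero ℓ] {lam s : ℝ} (hs : s ^ 2 = Real.tanh lam) (h : Fin ℓ → ℝ)
    (i : Fin ℓ) :
    m lam h i = u h i + (1 - u h i ^ 2) * logDerivZero s (fun j => u h (i + j)) := by
  have hup : ∀ t, u (Function.update h i t) = Function.update (u h) i (Real.tanh t) := by
    intro t
    funext k
    by_cases hk : k = i
    · subst hk; simp [u]
    · simp [u, hk]
  have hpos : ∀ h' : Fin ℓ → ℝ, 0 < ringTrace s (u h') := fun h' =>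
    ringTrace_pos hs fun k => Real.abs_tanh_lt_one _
  set c : ℝ := (∏ k ∈ univ.erase i, (Real.exp (h k) + Real.exp (-(h k)))) * Real.cosh lam ^ ℓ
    with hc
  have hcpos : 0 < c :=
    mul_pos (prod_pos fun k _ => by positivity) (pow_pos (Real.cosh_pos _) _)
  have hlog : (fun t => Real.log (Z lam (Function.update h i t))) = fun t =>
      Real.log c + Real.log (2 * Real.cosh t)
        + Real.log (ringTrace s (Function.update (u h) i (Real.tanh t))) := by
    funext t
    have hprod : ∏ k, (Real.exp (Function.update h i t k) + Real.exp (-(Function.update h i t k)))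
        = 2 * Real.cosh t * ∏ k ∈ univ.erase i, (Real.exp (h k) + Real.exp (-(h k))) := by
      rw [← mul_prod_erase univ _ (mem_univ i)]
      congr 1
      · rw [Function.update_self, Real.cosh_eq]; ring
      · refine prod_congr rfl fun k hk => ?_
        rw [Function.update_of_ne (ne_of_mem_erase hk)]
    have hcosh := Real.cosh_pos t
    have hR := hpos (Function.update h i t)
    rw [hup] at hR
    rw [Z_eq hs, hprod, hup, ← Real.log_mul hcpos.ne' (by positivity),
      ← Real.log_mul (by positivity) hR.ne', hc]
    congr 1
    ring
  have hui : Function.update (u h) i (Real.tanh (h i)) = u h := Function.update_eq_self _ _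
  have hR := hpos h
  have hcosh := Real.cosh_pos (h i)
  have hd1 : HasDerivAt (fun t => Real.log (2 * Real.cosh t)) (Real.tanh (h i)) (h i) := by
    refine (((Real.hasDerivAt_cosh (h i)).const_mul 2).log (by positivity)).congr_deriv ?_
    rw [Real.tanh_eq_sinh_div_cosh]
    field_simp
  have hd2 := ((hasDerivAt_ringTrace_update s (u h) i (Real.tanh (h i))).comp (h i)
    (hasDerivAt_tanh (h i))).log (by simpa only [Function.comp_apply, hui] using hR.ne')
  have hd := (hd1.const_add (Real.log c)).fun_add hd2
  rw [m, hlog]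
  refine hd.deriv.trans ?_
  rw [logDerivZero_shift]
  simp only [Function.comp_apply, hui]
  rw [u]
  ring

theorem log_ZStar_eq {ℓ : ℕ} [NeZero ℓ] {lam s : ℝ} (hs : s ^ 2 = Real.tanh lam) (h : Fin ℓ → ℝ) :
    Real.log (ZStar lam h) = Real.log (Real.cosh lam ^ ℓ) + Real.log (ringTrace s (u h)) := by
  have hR : 0 < ringTrace s (u h) := ringTrace_pos hs fun k => Real.abs_tanh_lt_one _
  have hp : 0 < ∏ i, (Real.exp (h i) + Real.exp (-(h i))) := prod_pos fun i _ => by positivity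
  rw [← Real.log_mul (pow_pos (Real.cosh_pos _) _).ne' hR.ne', ZStar, Z_eq hs]
  congr 1
  field_simp

/-- Nearest neighbour corrected logarithm of the ring trace. -/
def logTraceRem {ℓ : ℕ} [NeZero ℓ] (s lam : ℝ) (v : Fin ℓ → ℝ) : ℝ :=
  Real.log (ringTrace s v) - lam * ∑ i, v i * v (i + 1)

theorem H1_eq {ℓ : ℕ} [NeZero ℓ] {lam s : ℝ} (hs : s ^ 2 = Real.tanh lam) (hext : ℝ)
    (h : Fin ℓ → ℝ) : H1 lam hext h =
      ∑ i, ((h i - u h i - hext) * (1 - u h i ^ 2) * logDerivRem s lam (fun j => u h (i + j))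
        - (1 - u h i ^ 2) ^ 2 / 2 * logDerivZero s (fun j => u h (i + j)) ^ 2
        - lam * u h i ^ 2)
      - (logTraceRem s lam (u h) - logTraceRem s lam (0 : Fin ℓ → ℝ)) := by
  have hu0 : u (0 : Fin ℓ → ℝ) = 0 := by
    funext i; simp [u]
  have hsq : ∑ i, (u h (i + 1) - u h i) ^ 2
      = 2 * ∑ i, u h i ^ 2 - 2 * ∑ i, u h i * u h (i + 1) := by
    have h1 : ∑ i, u h (i + 1) ^ 2 = ∑ i, u h i ^ 2 :=
      Equiv.sum_comp (Equiv.addRight (1 : Fin ℓ)) fun i => u h i ^ 2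
    rw [two_mul]
    nth_rw 1 [← h1]
    rw [mul_sum, ← sum_add_distrib, ← sum_sub_distrib]
    exact sum_congr rfl fun i _ => by ring
  have hterm : ∀ i, (h i - u h i) * Phi lam h i - hext * Phi lam h i - Psi lam h i ^ 2 / 2
      = (h i - u h i - hext) * (1 - u h i ^ 2) * logDerivRem s lam (fun j => u h (i + j))
        - (1 - u h i ^ 2) ^ 2 / 2 * logDerivZero s (fun j => u h (i + j)) ^ 2 := by
    intro i
    rw [Phi, Psi, m_eq hs, logDerivRem, sub_eq_add_neg i 1]
    ring
  rw [H1, Theta, A0, log_ZStar_eq hs, log_ZStar_eq hs, hu0, hsq, sum_congr rfl fun i _ => hterm i,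
    sum_sub_distrib (f := fun i => _ - (1 - u h i ^ 2) ^ 2 / 2 * _), ← mul_sum, logTraceRem,
    logTraceRem]
  simp
  ring

theorem hasDerivAt_logTraceRem {ℓ : ℕ} [NeZero ℓ] {lam s : ℝ} (hs : s ^ 2 = Real.tanh lam)
    {v : Fin ℓ → ℝ} {r : ℝ} (hv : ∀ i, |r * v i| < 1) :
    HasDerivAt (fun r : ℝ => logTraceRem s lam fun i => r * v i)
      (∑ a, v a * logDerivRem s lam fun j => r * v (a + j)) r := by
  have hd : HasFDerivAt (fun w : Fin ℓ → ℝ => ringTrace s w)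
      (fderiv ℝ (fun w : Fin ℓ → ℝ => ringTrace s w) fun i => r * v i) fun i => r * v i :=
    (((contDiff_ringTrace (𝕜 := ℝ) (ℓ := ℓ) s (n := 1)).differentiable one_ne_zero) _).hasFDerivAt
  have hpart : ∀ a, fderiv ℝ (fun w : Fin ℓ → ℝ => ringTrace s w) (fun i => r * v i) (Pi.single a 1)
      = ringTrace s (Function.update (fun i => r * v i) a 1)
        - ringTrace s (Function.update (fun i => r * v i) a 0) := by
    intro a
    have h1 := hasDerivAt_ringTrace_update s (fun i => r * v i) a (r * v a)
    have hd' : HasFDerivAt (fun w : Fin ℓ → ℝ => ringTrace s w)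
        (fderiv ℝ (fun w : Fin ℓ → ℝ => ringTrace s w) fun i => r * v i)
        (Function.update (fun i => r * v i) a (r * v a)) := by
      rw [Function.update_eq_self a fun i => r * v i]; exact hd
    have h2 := hd'.comp_hasDerivAt (r * v a) (hasDerivAt_update (fun i => r * v i) a (r * v a))
    exact h2.unique h1
  have hline : HasDerivAt (fun r : ℝ => fun i => r * v i) v r := by
    rw [hasDerivAt_pi]
    intro i
    simpa using (hasDerivAt_id r).mul_const (v i)
  have hR : 0 < ringTrace s fun i => r * v i := ringTrace_pos hs hv
  have hcomp : HasDerivAt (fun r : ℝ => ringTrace s fun i => r * v i)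
      (fderiv ℝ (fun w : Fin ℓ → ℝ => ringTrace s w) (fun i => r * v i) v) r := by
    have h := hd.comp_hasDerivAt r hline
    exact h
  have hlog := hcomp.log hR.ne'
  have hv1 : v = ∑ a, v a • (Pi.single a 1 : Fin ℓ → ℝ) := by
    funext k
    simp [Finset.sum_apply, Pi.single_apply]
  have hval : fderiv ℝ (fun w : Fin ℓ → ℝ => ringTrace s w) (fun i => r * v i) v
      = ∑ a, v a * (ringTrace s (Function.update (fun i => r * v i) a 1)
        - ringTrace s (Function.update (fun i => r * v i) a 0)) := by
    generalize fderiv ℝ (fun w : Fin ℓ → ℝ => ringTrace s w) (fun i => r * v i) = A at hpart ⊢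
    conv_lhs => rw [hv1, map_sum]
    simp only [map_smul, smul_eq_mul, hpart]
  have hquad : HasDerivAt (fun r : ℝ => lam * ∑ i, r * v i * (r * v (i + 1)))
      (lam * (2 * r * ∑ i, v i * v (i + 1))) r := by
    have e : (fun r : ℝ => lam * ∑ i, r * v i * (r * v (i + 1)))
        = fun r : ℝ => lam * (r ^ 2 * ∑ i, v i * v (i + 1)) := by
      funext r
      congr 1
      rw [mul_sum]
      exact sum_congr rfl fun i _ => by ring
    rw [e]
    simpa using ((hasDerivAt_pow 2 r).mul_const (∑ i, v i * v (i + 1))).const_mul lam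
  refine (hlog.fun_sub hquad).congr_deriv ?_
  have hcyc : ∑ a, v a * v (a + -1) = ∑ i, v i * v (i + 1) := by
    rw [← Equiv.sum_comp (Equiv.addRight (1 : Fin ℓ))]
    refine sum_congr rfl fun i _ => ?_
    simp [mul_comm]
  rw [hval, sum_div]
  have hterm : ∀ a, v a * logDerivRem s lam (fun j => r * v (a + j))
      = v a * (ringTrace s (Function.update (fun i => r * v i) a 1)
        - ringTrace s (Function.update (fun i => r * v i) a 0)) / ringTrace s (fun i => r * v i)
        - lam * r * (v a * v (a + 1) + v a * v (a + -1)) := by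
    intro a
    rw [logDerivRem, logDerivZero_shift s (fun i => r * v i) a]
    ring
  rw [sum_congr rfl fun a _ => hterm a, sum_sub_distrib, ← mul_sum, sum_add_distrib, hcyc]
  ring

theorem exists_logTraceRem_bound : ∃ C : ℝ, 0 < C ∧ ∀ (ℓ : ℕ) [NeZero ℓ] (s lam : ℝ)
    (v : Fin ℓ → ℝ), 0 ≤ s → 0 ≤ lam → lam ≤ 1 / 1000 → s ^ 2 = Real.tanh lam →
    (∀ a, |v a| < 1) →
    |logTraceRem s lam v - (∑ a, logTraceRem s lam fun _ : Fin ℓ => v a) / ℓ|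
      ≤ C * lam ^ 2 * ∑ a, (v a - v (a + 1)) ^ 2 := by
  obtain ⟨C, hC, hmain⟩ := exists_logDeriv_sum_bounds
  refine ⟨2 * C, by positivity, ?_⟩
  intro ℓ _ s lam v hs hlam hlam1 hst hv
  have hℓ : (ℓ : ℝ) ≠ 0 := Nat.cast_ne_zero.2 (NeZero.ne ℓ)
  set Δ := ∑ a, (v a - v (a + 1)) ^ 2
  have hΔ : 0 ≤ Δ := sum_nonneg fun _ _ => sq_nonneg _
  have hrv : ∀ r ∈ Set.Icc (0 : ℝ) 1, ∀ a, |r * v a| < 1 := by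
    intro r hr a
    rw [abs_mul, abs_of_nonneg hr.1]
    exact (mul_le_of_le_one_left (abs_nonneg _) hr.2).trans_lt (hv a)
  set Y : ℝ → ℝ := fun r => (logTraceRem s lam fun i => r * v i)
    - (∑ a, logTraceRem s lam fun _ : Fin ℓ => r * v a) / ℓ with hY
  set Y' : ℝ → ℝ := fun r => ∑ a, v a * (logDerivRem s lam (fun j => r * v (a + j))
    - logDerivRem s lam fun _ : Fin ℓ => r * v a) with hY'
  have hder : ∀ r ∈ Set.Icc (0 : ℝ) 1, HasDerivWithinAt Y (Y' r) (Set.Icc 0 1) r := by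
    intro r hr
    have h1 := hasDerivAt_logTraceRem hst (hrv r hr)
    have h2 : ∀ a ∈ univ, HasDerivAt (fun r : ℝ => logTraceRem s lam fun _ : Fin ℓ => r * v a)
        (∑ _b : Fin ℓ, v a * logDerivRem s lam fun _ : Fin ℓ => r * v a) r := fun a _ =>
      hasDerivAt_logTraceRem (v := fun _ => v a) hst fun _ => hrv r hr a
    have h3 := h1.fun_sub ((HasDerivAt.fun_sum h2).div_const (ℓ : ℝ))
    refine (h3.congr_deriv ?_).hasDerivWithinAt
    simp only [hY', sum_const, card_univ, Fintype.card_fin, nsmul_eq_mul, mul_sub, sum_sub_distrib]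
    rw [← mul_sum, mul_div_cancel_left₀ _ hℓ]
  have hbound : ∀ r ∈ Set.Ico (0 : ℝ) 1, ‖Y' r‖ ≤ 2 * C * lam ^ 2 * Δ := by
    intro r hr
    rcases hr.1.eq_or_lt with rfl | hr0
    · simp only [hY', zero_mul, sub_self, mul_zero, sum_const_zero, norm_zero]
      positivity
    have h := (hmain ℓ s lam 1 1 1 id (fun i => r * v i) hs hlam hlam1 hst zero_le_one zero_le_one
      le_rfl (fun a => (hrv r ⟨hr.1, hr.2.le⟩ a).le) (fun x hx => hx) (fun x y _ _ => by simp)).1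
    have e1 : ∑ a, id (r * v a) * (logDerivRem s lam (fun j => r * v (a + j))
        - logDerivRem s lam fun _ : Fin ℓ => r * v a) = r * Y' r := by
      rw [hY', mul_sum]
      exact sum_congr rfl fun a _ => by simp [mul_assoc]
    have e2 : ∑ a, (r * v a - r * v (a + 1)) ^ 2 = r ^ 2 * Δ := by
      rw [mul_sum]
      exact sum_congr rfl fun a _ => by ring
    rw [e1, e2, abs_mul, abs_of_pos hr0] at h
    have h4 : r * |Y' r| ≤ r * (2 * C * lam ^ 2 * Δ * r) := h.trans_eq (by ring)
    rw [Real.norm_eq_abs]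
    refine (le_of_mul_le_mul_left h4 hr0).trans ?_
    exact mul_le_of_le_one_right (by positivity) hr.2.le
  have h := norm_image_sub_le_of_norm_deriv_le_segment_01' hder hbound
  have hY0 : Y 0 = 0 := by
    simp only [hY, zero_mul, sum_const, card_univ, Fintype.card_fin, nsmul_eq_mul]
    rw [mul_div_cancel_left₀ _ hℓ, sub_self]
  have hY1 : Y 1 = logTraceRem s lam v - (∑ a, logTraceRem s lam fun _ : Fin ℓ => v a) / ℓ := by
    simp only [hY, one_mul]
  rwa [hY0, hY1, sub_zero, Real.norm_eq_abs] at h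

/-- The value of `H1` on a constant configuration, per site. -/
theorem H1_const_eq {ℓ : ℕ} [NeZero ℓ] {lam s : ℝ} (hs : s ^ 2 = Real.tanh lam) (hext x : ℝ) :
    H1 lam hext (fun _ : Fin ℓ => x) / ℓ =
      (x - Real.tanh x - hext) * (1 - Real.tanh x ^ 2)
          * logDerivRem s lam (fun _ : Fin ℓ => Real.tanh x)
        - (1 - Real.tanh x ^ 2) ^ 2 / 2 * logDerivZero s (fun _ : Fin ℓ => Real.tanh x) ^ 2
        - lam * Real.tanh x ^ 2
      - ((logTraceRem s lam fun _ : Fin ℓ => Real.tanh x)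
        - logTraceRem s lam (0 : Fin ℓ → ℝ)) / ℓ := by
  have hℓ : (ℓ : ℝ) ≠ 0 := Nat.cast_ne_zero.2 (NeZero.ne ℓ)
  have hu : u (fun _ : Fin ℓ => x) = fun _ => Real.tanh x := rfl
  rw [H1_eq hs, hu]
  simp only [sum_const, card_univ, Fintype.card_fin, nsmul_eq_mul]
  rw [sub_div, mul_div_cancel_left₀ _ hℓ]

theorem H1_sub_eq {ℓ : ℕ} [NeZero ℓ] {lam s : ℝ} (hs : s ^ 2 = Real.tanh lam) (hext : ℝ)
    (h : Fin ℓ → ℝ) :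
    H1 lam hext h - ∑ a, H1 lam hext (fun _ : Fin ℓ => h a) / ℓ =
      ∑ a, (Real.artanh (u h a) - u h a - hext) * (1 - u h a ^ 2)
          * (logDerivRem s lam (fun j => u h (a + j)) - logDerivRem s lam fun _ : Fin ℓ => u h a)
        - 1 / 2 * ∑ a, (1 - u h a ^ 2) ^ 2
          * (logDerivZero s (fun j => u h (a + j)) ^ 2
            - logDerivZero s (fun _ : Fin ℓ => u h a) ^ 2)
        - (logTraceRem s lam (u h) - (∑ a, logTraceRem s lam fun _ : Fin ℓ => u h a) / ℓ) := by
  have hℓ : (ℓ : ℝ) ≠ 0 := Nat.cast_ne_zero.2 (NeZero.ne ℓ)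
  have hc : ∑ _a : Fin ℓ, logTraceRem s lam (0 : Fin ℓ → ℝ) / ℓ
      = logTraceRem s lam (0 : Fin ℓ → ℝ) := by
    rw [sum_const, card_univ, Fintype.card_fin, nsmul_eq_mul, mul_div_cancel₀ _ hℓ]
  have hart : ∀ a, Real.artanh (u h a) = h a := fun a => Real.artanh_tanh _
  rw [H1_eq hs, sum_congr rfl fun a _ => H1_const_eq hs hext (h a)]
  simp only [hart, sub_div, sum_sub_distrib, mul_sub, hc, sum_div, mul_sum]
  have e : ∀ a, Real.tanh (h a) = u h a := fun _ => rfl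
  simp only [e, div_mul_eq_mul_div, one_mul]
  ring

theorem abs_le_artanh_bound {hplus x : ℝ} (hx : |x| ≤ Real.tanh hplus) :
    |Real.artanh x| ≤ hplus ∧ |x| < 1 := by
  have h1 := Real.tanh_lt_one hplus
  obtain ⟨hx1, hx2⟩ := abs_le.1 hx
  refine ⟨abs_le.2 ⟨?_, ?_⟩, hx.trans_lt h1⟩
  · have := Real.artanh_le_artanh (x := Real.tanh (-hplus)) (y := x)
      (Real.neg_one_lt_tanh _) (by linarith) (by rwa [Real.tanh_neg])
    rwa [Real.artanh_tanh] at this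
  · have := Real.artanh_le_artanh (x := x) (y := Real.tanh hplus) (by linarith) h1 hx2
    rwa [Real.artanh_tanh] at this

/-- The weight in front of the remainder of the logarithmic derivative is bounded and Lipschitz. -/
theorem weight_bounds {hplus hext : ℝ} (hp : 0 < hplus) (he : hext ∈ Set.Icc (0 : ℝ) hStar) :
    (∀ x, |x| ≤ Real.tanh hplus →
      |(Real.artanh x - x - hext) * (1 - x ^ 2)| ≤ hplus + 1 + hStar) ∧
    ∀ x y, |x| ≤ Real.tanh hplus → |y| ≤ Real.tanh hplus →
      |(Real.artanh x - x - hext) * (1 - x ^ 2) - (Real.artanh y - y - hext) * (1 - y ^ 2)|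
        ≤ (1 + 2 * (hplus + 1 + hStar)) * |x - y| := by
  have h0 : ∀ x, |x| ≤ Real.tanh hplus → |Real.artanh x - x - hext| ≤ hplus + 1 + hStar := by
    intro x hx
    obtain ⟨h1, h2⟩ := abs_le_artanh_bound hx
    have h3 : |hext| ≤ hStar := by rw [abs_of_nonneg he.1]; exact he.2
    have h4 := abs_sub (Real.artanh x - x) hext
    have h5 := abs_sub (Real.artanh x) x
    linarith
  have hM : 0 < hplus + 1 + hStar := by linarith [he.1.trans he.2]
  refine ⟨fun x hx => ?_, fun x y hx hy => ?_⟩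
  · have h2 := (abs_le_artanh_bound hx).2
    have h3 : |1 - x ^ 2| ≤ 1 := by
      have := (sq_lt_one_iff_abs_lt_one x).2 h2
      rw [abs_le]
      constructor <;> nlinarith [sq_nonneg x]
    rw [abs_mul]
    exact (mul_le_of_le_one_right (abs_nonneg _) h3).trans (h0 x hx)
  · have hconv : Convex ℝ (Set.Icc (-Real.tanh hplus) (Real.tanh hplus)) := convex_Icc _ _
    have hder : ∀ t ∈ Set.Icc (-Real.tanh hplus) (Real.tanh hplus), HasDerivWithinAt
        (fun t => (Real.artanh t - t - hext) * (1 - t ^ 2))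
        (t ^ 2 - 2 * t * (Real.artanh t - t - hext))
        (Set.Icc (-Real.tanh hplus) (Real.tanh hplus)) t := by
      intro t ht
      have ht1 := abs_lt.1 (abs_le_artanh_bound (abs_le.2 ht)).2
      have hne : 1 - t ^ 2 ≠ 0 := by nlinarith [ht1.1, ht1.2]
      have h1 := (((hasDerivAt_artanh ht1).sub (hasDerivAt_id t)).sub_const hext).mul
        ((hasDerivAt_pow 2 t).const_sub 1)
      refine (h1.congr_deriv ?_).hasDerivWithinAt
      simp
      field_simp
      ring
    have h := hconv.norm_image_sub_le_of_norm_hasDerivWithin_le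
      (C := 1 + 2 * (hplus + 1 + hStar)) hder (fun t ht => ?_) (abs_le.1 hy) (abs_le.1 hx)
    · simpa [Real.norm_eq_abs] using h
    · have ht' := abs_le.2 ht
      have h2 := (abs_le_artanh_bound ht').2
      have h3 := h0 t ht'
      rw [Real.norm_eq_abs]
      refine (abs_sub _ _).trans ?_
      rw [abs_mul, abs_mul, abs_pow, abs_two]
      have h4 : |t| ^ 2 ≤ 1 := pow_le_one₀ (abs_nonneg _) h2.le
      have h5 : 2 * |t| * |Real.artanh t - t - hext| ≤ 2 * 1 * (hplus + 1 + hStar) := by gcongr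
      linarith

theorem sq_weight_lipschitz {x y : ℝ} (hx : |x| ≤ 1) (hy : |y| ≤ 1) :
    |(1 - x ^ 2) ^ 2 - (1 - y ^ 2) ^ 2| ≤ 4 * |x - y| := by
  have e : (1 - x ^ 2) ^ 2 - (1 - y ^ 2) ^ 2 = ((x + y) * (x ^ 2 + y ^ 2 - 2)) * (x - y) := by ring
  rw [e, abs_mul]
  refine mul_le_mul_of_nonneg_right ?_ (abs_nonneg _)
  rw [abs_mul]
  have h1 : |x + y| ≤ 2 := (abs_add_le x y).trans (by linarith)
  have h2 : |x ^ 2 + y ^ 2 - 2| ≤ 2 := by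
    have := (sq_le_one_iff_abs_le_one x).2 hx
    have := (sq_le_one_iff_abs_le_one y).2 hy
    rw [abs_le]
    constructor <;> nlinarith [sq_nonneg x, sq_nonneg y]
  calc |x + y| * |x ^ 2 + y ^ 2 - 2| ≤ 2 * 2 := by gcongr
    _ = 4 := by norm_num

/-- `H1` differs from its locally constant approximation by a multiple of the Dirichlet form. -/
theorem exists_H1_bound {hplus : ℝ} (hp : 0 < hplus) : ∃ c : ℝ, 0 < c ∧ ∀ lam : ℝ, 0 < lam →
    lam < 1 / 1000 → ∀ (ℓ : ℕ) [NeZero ℓ], ∀ hext ∈ Set.Icc (0 : ℝ) hStar, ∀ h : Fin ℓ → ℝ,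
    (∀ i, |h i| ≤ hplus) →
      |H1 lam hext h - ∑ a, H1 lam hext (fun _ : Fin ℓ => h a) / ℓ|
        ≤ c * lam ^ 2 * ∑ i, (u h i - u h (i + 1)) ^ 2 := by
  obtain ⟨C₁, hC₁, hb⟩ := exists_logDeriv_sum_bounds
  obtain ⟨C₂, hC₂, hY⟩ := exists_logTraceRem_bound
  have hst : 0 < hStar := by linarith [hStar_spec.1]
  set M := hplus + 1 + hStar with hM
  refine ⟨C₁ * (M + (1 + 2 * M)) + C₁ * (1 + 4) + C₂, by positivity, ?_⟩
  intro lam hlam hlam1 ℓ _ hext he h hh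
  set s := √(Real.tanh lam) with hs
  have hs0 : 0 ≤ s := Real.sqrt_nonneg _
  have hs2 : s ^ 2 = Real.tanh lam := Real.sq_sqrt (tanh_bounds hlam.le).1
  have hU : ∀ a, |u h a| ≤ Real.tanh hplus := by
    intro a
    obtain ⟨h1, h2⟩ := abs_le.1 (hh a)
    rw [abs_le, ← Real.tanh_neg]
    exact ⟨monotone_tanh h1, monotone_tanh h2⟩
  have hU0 : 0 ≤ Real.tanh hplus := (tanh_bounds hp.le).1
  have hU1 : Real.tanh hplus ≤ 1 := (Real.tanh_lt_one _).le
  obtain ⟨hw1, hw2⟩ := weight_bounds hp he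
  have b1 := (hb ℓ s lam M (1 + 2 * M) (Real.tanh hplus)
    (fun x => (Real.artanh x - x - hext) * (1 - x ^ 2)) (u h) hs0 hlam.le hlam1.le hs2
    (by positivity) hU0 hU1 hU hw1 hw2).1
  have b2 := (hb ℓ s lam 1 4 1 (fun x => (1 - x ^ 2) ^ 2) (u h) hs0 hlam.le hlam1.le hs2
    (by norm_num) zero_le_one le_rfl (fun a => (hU a).trans hU1) (fun x hx => by
      have := (sq_le_one_iff_abs_le_one x).2 hx
      rw [abs_of_nonneg (sq_nonneg _)]
      nlinarith [sq_nonneg x]) (fun x y hx hy => sq_weight_lipschitz hx hy)).2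
  have b3 := hY ℓ s lam (u h) hs0 hlam.le hlam1.le hs2 fun a => Real.abs_tanh_lt_one _
  rw [H1_sub_eq hs2]
  refine (abs_sub _ _).trans ((add_le_add_left (abs_sub _ _) _).trans ?_)
  rw [abs_mul, abs_of_pos (by norm_num : (0 : ℝ) < 1 / 2)]
  set Δ := ∑ a, (u h a - u h (a + 1)) ^ 2
  have hΔ : 0 ≤ Δ := sum_nonneg fun _ _ => sq_nonneg _
  have hnn : 0 ≤ C₁ * (1 + 4) * lam ^ 2 * Δ := by positivity
  linarith

theorem continuous_H1_const {ℓ : ℕ} [NeZero ℓ] {lam : ℝ} (hlam : 0 ≤ lam) (hext : ℝ) :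
    Continuous fun x : ℝ => H1 lam hext (fun _ : Fin ℓ => x) / ℓ := by
  set s := √(Real.tanh lam) with hs
  have hs2 : s ^ 2 = Real.tanh lam := Real.sq_sqrt (tanh_bounds hlam).1
  have hct : Continuous Real.tanh :=
    continuous_iff_continuousAt.2 fun x => (hasDerivAt_tanh x).continuousAt
  have hcR : Continuous fun v : Fin ℓ → ℝ => ringTrace s v :=
    (contDiff_ringTrace (𝕜 := ℝ) s (n := 0)).continuous
  have hpos : ∀ x : ℝ, ringTrace s (fun _ : Fin ℓ => Real.tanh x) ≠ 0 := fun x =>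
    (ringTrace_pos hs2 fun _ => Real.abs_tanh_lt_one x).ne'
  have hc1 : Continuous fun x : ℝ => (fun _ : Fin ℓ => Real.tanh x) := by fun_prop
  have hcU : ∀ t : ℝ, Continuous fun x : ℝ =>
      ringTrace s (Function.update (fun _ : Fin ℓ => Real.tanh x) 0 t) := fun t =>
    hcR.comp (hc1.update 0 continuous_const)
  have hcw : Continuous fun x : ℝ => logDerivZero s fun _ : Fin ℓ => Real.tanh x :=
    ((hcU 1).sub (hcU 0)).div (hcR.comp hc1) hpos
  have hcV : Continuous fun x : ℝ => logDerivRem s lam fun _ : Fin ℓ => Real.tanh x :=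
    hcw.sub (by fun_prop)
  have hcL : Continuous fun x : ℝ => logTraceRem s lam fun _ : Fin ℓ => Real.tanh x :=
    ((hcR.comp hc1).log hpos).sub (by fun_prop)
  simp only [H1_const_eq hs2]
  fun_prop

end

end IsingLayers

theorem mainTheorem10 :
    ∃ lam₀ : ℝ, 0 < lam₀ ∧ ∀ hplus : ℝ, 0 < hplus → ∃ c : ℝ, 0 < c ∧
      ∀ lam : ℝ, 0 < lam → lam < lam₀ →
      ∀ (ℓ : ℕ) [NeZero ℓ],
      ∀ hext ∈ Set.Icc (0 : ℝ) IsingLayers.hStar,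
      ∃ (f : ℝ → ℝ) (b : Fin ℓ → Fin ℓ → (Fin ℓ → ℝ) → ℝ),
        ContinuousOn f (Set.Icc (-1) 1) ∧
        ∀ h : Fin ℓ → ℝ, (∀ i, |h i| ≤ hplus) →
          IsingLayers.H1 lam hext h
              = (∑ i, f (IsingLayers.u h i))
                + ∑ i, ∑ j ∈ Finset.Ioi i, b i j (IsingLayers.u h)
                    * (IsingLayers.u h i - IsingLayers.u h j) ^ 2 ∧
          -c * lam ^ (1 + 2 / 3 : ℝ) * ∑ i, (IsingLayers.u h i - IsingLayers.u h (i + 1)) ^ 2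
            ≤ ∑ i, ∑ j ∈ Finset.Ioi i, b i j (IsingLayers.u h)
                * (IsingLayers.u h i - IsingLayers.u h j) ^ 2 := by
  refine ⟨1 / 1000, by norm_num, fun hplus hp => ?_⟩
  obtain ⟨c, hc, hbound⟩ := IsingLayers.exists_H1_bound hp
  refine ⟨c, hc, fun lam hlam hlam1 ℓ _ hext he => ?_⟩
  set U := Real.tanh hplus
  set F : ℝ → ℝ := fun x => IsingLayers.H1 lam hext (fun _ : Fin ℓ => x) / ℓ with hF
  set D : (Fin ℓ → ℝ) → ℝ := fun v =>
    IsingLayers.H1 lam hext (fun i => Real.artanh (v i)) - ∑ i, F (Real.artanh (v i)) with hD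
  set S : (Fin ℓ → ℝ) → ℝ := fun v => ∑ i, ∑ j ∈ Finset.Ioi i, (v i - v j) ^ 2 with hS
  have hU0 : 0 ≤ U := (IsingLayers.tanh_bounds hp.le).1
  have hU1 : U < 1 := Real.tanh_lt_one _
  have hcl : ∀ t, max (-U) (min U t) ∈ Set.Ioo (-1 : ℝ) 1 := fun t =>
    ⟨lt_of_lt_of_le (by linarith) (le_max_left _ _),
      max_lt (by linarith) ((min_le_left _ _).trans_lt hU1)⟩
  refine ⟨fun t => F (Real.artanh (max (-U) (min U t))), fun _ _ v => D v / S v, ?_, ?_⟩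
  · refine Continuous.continuousOn ((IsingLayers.continuous_H1_const hlam.le hext).comp ?_)
    refine continuous_iff_continuousAt.2 fun t => ContinuousAt.comp (g := Real.artanh)
      (IsingLayers.hasDerivAt_artanh (hcl t)).continuousAt ?_
    fun_prop
  · intro h hh
    have hart : ∀ i, Real.artanh (IsingLayers.u h i) = h i := fun i => Real.artanh_tanh _
    have hclu : ∀ i, max (-U) (min U (IsingLayers.u h i)) = IsingLayers.u h i := by
      intro i
      obtain ⟨h1, h2⟩ := abs_le.1 (hh i)
      have h3 : IsingLayers.u h i ≤ U := IsingLayers.monotone_tanh h2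
      have h4 : -U ≤ IsingLayers.u h i := by
        have := IsingLayers.monotone_tanh h1
        rwa [Real.tanh_neg] at this
      rw [min_eq_right h3, max_eq_right h4]
    have hDu : D (IsingLayers.u h) = IsingLayers.H1 lam hext h - ∑ i, F (h i) := by
      simp only [hD, hart]
    have hsum : ∑ i, ∑ j ∈ Finset.Ioi i, D (IsingLayers.u h) / S (IsingLayers.u h)
        * (IsingLayers.u h i - IsingLayers.u h j) ^ 2 = D (IsingLayers.u h) := by
      simp only [← Finset.mul_sum]
      rcases eq_or_ne (S (IsingLayers.u h)) 0 with h0 | h0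
      · have hall : ∀ i j, IsingLayers.u h i = IsingLayers.u h j := by
          have h1 : ∀ i j, i < j → IsingLayers.u h i = IsingLayers.u h j := by
            intro i j hij
            have h2 := (Finset.sum_eq_zero_iff_of_nonneg fun i _ =>
              Finset.sum_nonneg fun j _ => sq_nonneg _).1 h0 i (Finset.mem_univ i)
            have h3 := (Finset.sum_eq_zero_iff_of_nonneg fun j _ => sq_nonneg _).1 h2 j
              (Finset.mem_Ioi.2 hij)
            exact sub_eq_zero.1 (pow_eq_zero_iff two_ne_zero |>.1 h3)
          intro i j
          rcases lt_trichotomy i j with hij | rfl | hij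
          · exact h1 i j hij
          · rfl
          · exact (h1 j i hij).symm
        have hconst : h = fun _ => h 0 := by
          funext i
          rw [← hart i, hall i 0, hart]
        have hz : D (IsingLayers.u h) = 0 := by
          have hℓ : (ℓ : ℝ) ≠ 0 := Nat.cast_ne_zero.2 (NeZero.ne ℓ)
          rw [hDu, hconst]
          simp only [hF, Finset.sum_const, Finset.card_univ, Fintype.card_fin, nsmul_eq_mul]
          rw [mul_div_cancel₀ _ hℓ, sub_self]
        rw [hz]; simp
      · exact div_mul_cancel₀ _ h0
    rw [hsum, hDu]
    simp only [hclu, hart]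
    refine ⟨by ring, ?_⟩
    have hb := (abs_le.1 (hbound lam hlam hlam1 ℓ hext he h hh)).1
    refine le_trans ?_ hb
    have hΔ : 0 ≤ ∑ i, (IsingLayers.u h i - IsingLayers.u h (i + 1)) ^ 2 :=
      Finset.sum_nonneg fun _ _ => sq_nonneg _
    have hpow : lam ^ 2 ≤ lam ^ (1 + 2 / 3 : ℝ) := by
      rw [← Real.rpow_natCast]
      exact Real.rpow_le_rpow_of_exponent_ge hlam (by linarith) (by norm_num)
    have := mul_le_mul_of_nonneg_right (mul_le_mul_of_nonneg_left hpow hc.le) hΔ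
    linarith
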